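/- Notation. Functions on $(0,\infty)$ are extended by $0$ to $\mathbb{R}$. $B(0,\infty)^+$ is the set of nonnegative bounded Borel functions on $(0,\infty)$, and $C^1(0,\infty)^+$ is the set of nonnegative bounded continuously differentiable functions on $(0,\infty)$ with bounded derivative. $\mathfrak{N}(0,\infty)$ is the space of finite integer-valued Borel measures on $(0,\infty)$ with the topology of weak convergence and its Borel $\sigma$-algebra, $\mathfrak{N}(0,\infty)^\circ=\mathfrak{N}(0,\infty)\setminus\{0\}$, and $\langle\nu,f\rangle=\int_{(0,\infty)} f\,d\nu$. Parameters. Let $\alpha\in C^1(0,\infty)^+$. For each $x>0$ let $(p(x,i))_{i\ge 0}$ be a probability distribution on $\{0,1,2,\dots\}$ with $p(\cdot,i)\in C^1(0,\infty)^+$ for every $i$, and put $g(x,z)=\sum_{i\ge 0} p(x,i)z^i$ for $z\in[0,1]$ and $g'(x,1-)=\sum_{i\ge 1} i\,p(x,i)$; assume $\sup_{x>0} g'(x,1-)<\infty$. Let $G$ be a probability measure on $(0,\infty)$ without atoms; write $G(t)=G((0,t])$. Let $L$ be a finite measure on $\mathfrak{N}(0,\infty)^\circ$ and $\psi(f)=\int(1-e^{-\langle\nu,f\rangle})\,L(d\nu)$.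 For $f\in B(0,\infty)^+$ let $(t,x)\mapsto u_tf(x)$, $t\ge0$, $x>0$, be the unique nonnegative Borel solution of $$u_tf(x)=f(x-t)+\int_0^t\alpha(x-s)\big[1-g\big(x-s,\langle G,e^{-u_{t-s}f}\rangle\big)\big]\,ds .$$ The $(\alpha,g,G,\psi)$-process (the remaining-lifetime age-structured branching process with immigration) is the Markov process in $\mathfrak{N}(0,\infty)$ whose transition semigroup $(P_t)_{t\ge0}$ is given by $$\int_{\mathfrak{N}(0,\infty)} e^{-\langle\nu,f\rangle}P_t(\sigma,d\nu)=\exp\Big\{-\langle\sigma,u_tf\rangle-\int_0^t\psi(u_sf)\,ds\Big\},\qquad f\in B(0,\infty)^+ .$$ Theorem. Assume that (i) $\displaystyle\int_0^\infty ds\int_{(s,\infty)}\alpha(x-s)g'(x-s,1-)\,G(dx)<1$; (ii) $\alpha_1\in(0,\infty)$ is such that $t\mapsto e^{\alpha_1t}[1-G(t)]$ is directly Riemann integrable over $[0,\infty)$ and $\displaystyle\int_0^\infty e^{\alpha_1s}\,ds\int_{(s,\infty)}\alpha(x-s)g'(x-s,1-)\,G(dx)=1$; (iii) $\displaystyle\int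 L(d\nu)\int_{(0,\infty)}e^{\alpha_1x}\,\nu(dx)<\infty$. Here a function $h\ge0$ on $[0,\infty)$ is directly Riemann integrable if, with $M_n(a)$ and $m_n(a)$ the supremum and infimum of $h$ over $[(n-1)a,na]$, one has $\sum_{n\ge1}aM_n(a)<\infty$ for every $a>0$ and the limits $\lim_{a\to0+}\sum_{n\ge 1} aM_n(a)$ and $\lim_{a\to0+}\sum_{n\ge 1} am_n(a)$ exist and are equal. Then there is a probability measure $\eta$ on $\mathfrak{N}(0,\infty)$ such that, for every $\sigma\in\mathfrak{N}(0,\infty)$, $P_t(\sigma,\cdot)$ converges weakly to $\eta$ as $t\to\infty$. Moreover, for every $f\in B(0,\infty)^+$ one has $\int_0^\infty\psi(u_sf)\,ds<\infty$ and $$\int_{\mathfrak{N}(0,\infty)}e^{-\langle\nu,f\rangle}\,\eta(d\nu)=\exp\Big\{-\int_0^\infty\psi(u_sf)\,ds\Big\}.$$ -/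

import Mathlib

open MeasureTheory ProbabilityTheory Filter Topology
open scoped NNReal ENNReal

noncomputable section

namespace AgeBranching

/-- The half-line `(0, ∞)` of remaining lifetimes, with its usual topology and Borel sets. -/
abbrev Life : Type := Set.Ioi (0 : ℝ)

/-- A function on `(0, ∞)`, extended by `0` to the whole real line. -/
def zext (h : Life → ℝ) (x : ℝ) : ℝ := if hx : x ∈ Set.Ioi (0 : ℝ) then h ⟨x, hx⟩ else 0

/-- `h` is nonnegative, bounded and continuously differentiable on `(0, ∞)`, with bounded
derivative. -/
structure IsC1BddPos (h : Life → ℝ) : Prop where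
  nonneg : ∀ x, 0 ≤ h x
  bdd : ∃ K : ℝ, ∀ x, h x ≤ K
  contDiffOn : ContDiffOn ℝ 1 (zext h) (Set.Ioi 0)
  deriv_bdd : ∃ K : ℝ, ∀ x : Life, |deriv (zext h) x| ≤ K

/-- `B(0, ∞)⁺`: the nonnegative bounded Borel functions on `(0, ∞)`. -/
structure BPos where
  toFun : Life → ℝ
  measurable : Measurable toFun
  nonneg : ∀ x, 0 ≤ toFun x
  bdd : ∃ K : ℝ, ∀ x, toFun x ≤ K

/-- `𝔑(0, ∞)`: the finite integer-valued Borel measures on `(0, ∞)`. -/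
def IntMeasure : Type :=
  {ν : FiniteMeasure Life // ∀ B : Set Life, MeasurableSet B → ∃ n : ℕ, ν B = n}

namespace IntMeasure

/-- The topology of weak convergence. -/
instance : TopologicalSpace IntMeasure := instTopologicalSpaceSubtype

instance : MeasurableSpace IntMeasure := borel IntMeasure

instance : BorelSpace IntMeasure := ⟨rfl⟩

/-- The underlying measure. -/
def toMeasure (ν : IntMeasure) : Measure Life := (ν.1 : Measure Life)

/-- `⟨ν, f⟩`. -/
def pair (ν : IntMeasure) (f : Life → ℝ) : ℝ := ∫ x, f x ∂ν.toMeasure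

end IntMeasure

/-- `𝔑(0, ∞)° = 𝔑(0, ∞) ∖ {0}`. -/
abbrev NonzeroIntMeasure : Type := {ν : IntMeasure // ν.toMeasure ≠ 0}

/-- The parameters `(α, g, G)` of the branching mechanism: the birth rate `α`, the offspring laws
`p(x, ·)` (with generating functions `g(x, ·)`) and the lifetime law `G`, which has a continuous
distribution function. -/
structure BranchingParams where
  α : Life → ℝ
  α_c1 : IsC1BddPos α
  p : Life → PMF ℕ
  p_c1 : ∀ i, IsC1BddPos fun x => (p x i).toReal
  sup_mean_lt_top : ⨆ x, ∑' i : ℕ, p x i * (i : ℝ≥0∞) < ⊤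
  G : Measure Life
  isProbabilityMeasure_G : IsProbabilityMeasure G
  nullSingletonClass_G : NullSingletonClass G

attribute [instance] BranchingParams.isProbabilityMeasure_G BranchingParams.nullSingletonClass_G

namespace BranchingParams

variable (D : BranchingParams)

/-- The generating function `g(x, z) = ∑ i, p(x, i) z ^ i`, for `z ∈ [0, 1]`. -/
def g (x : Life) (z : ℝ) : ℝ := ∑' i : ℕ, (D.p x i).toReal * z ^ i

/-- The mean offspring number `g'(x, 1-) = ∑ i, p(x, i) i`. -/
def mean (x : Life) : ℝ := (∑' i : ℕ, D.p x i * (i : ℝ≥0∞)).toReal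

/-- `u` is a nonnegative Borel solution `(t, x) ↦ u t x` of
`u_t(x) = f(x - t) + ∫_0^t α(x - s) [1 - g(x - s, ⟨G, exp(-u_{t-s})⟩)] ds`,
where functions on `(0, ∞)` are extended by `0`. -/
structure IsCumulant (f : BPos) (u : ℝ≥0 → Life → ℝ) : Prop where
  measurable : Measurable (Function.uncurry u)
  nonneg : ∀ t x, 0 ≤ u t x
  eqn : ∀ (t : ℝ≥0) (x : Life), u t x = zext f.toFun (x - t) +
    ∫ s in (0 : ℝ)..t, zext D.α (x - s) *
      (1 - zext (fun y => D.g y (∫ z, Real.exp (-u (t - s).toNNReal z) ∂D.G)) (x - s))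

/-! ### The cumulant equation is well posed -/

lemma measurable_zext {h : Life → ℝ} (hh : Measurable h) : Measurable (zext h) := by
  unfold zext
  exact Measurable.dite (s := Set.Ioi (0 : ℝ)) hh
    (g := fun _ => (0 : ℝ)) measurable_const measurableSet_Ioi

lemma IsC1BddPos_measurable {h : Life → ℝ} (hh : IsC1BddPos h) : Measurable h := by
  have h1 : Continuous ((Set.Ioi (0 : ℝ)).domRestrict (zext h)) :=
    continuousOn_iff_continuous_domRestrict.1 hh.contDiffOn.continuousOn
  have h2 : (Set.Ioi (0 : ℝ)).domRestrict (zext h) = h := by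
    ext x
    simp [zext, Set.domRestrict]
  rw [← h2]
  exact h1.measurable

lemma p_hasSum (x : Life) : HasSum (fun i => (D.p x i).toReal) 1 := by
  have h := (D.p x).tsum_coe
  have h2 : Summable fun i => (D.p x i).toReal :=
    ENNReal.summable_toReal (by rw [h]; exact ENNReal.one_ne_top)
  have h3 : ∑' i, (D.p x i).toReal = 1 := by
    rw [← ENNReal.tsum_toReal_eq (fun i => (D.p x).apply_ne_top i), h]; simp
  exact h3 ▸ h2.hasSum

lemma g_summable (x : Life) {z : ℝ} (hz : z ∈ Set.Icc (0 : ℝ) 1) :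
    Summable fun i : ℕ => (D.p x i).toReal * z ^ i :=
  (D.p_hasSum x).summable.of_nonneg_of_le
    (fun i => mul_nonneg ENNReal.toReal_nonneg (pow_nonneg hz.1 i))
    (fun _ => mul_le_of_le_one_right ENNReal.toReal_nonneg (pow_le_one₀ hz.1 hz.2))

lemma exists_mean_bound : ∃ m : ℝ, 0 ≤ m ∧ ∀ x, Summable (fun i : ℕ => (D.p x i).toReal * i) ∧
    ∑' i : ℕ, (D.p x i).toReal * i ≤ m := by
  refine ⟨(⨆ x, ∑' i : ℕ, D.p x i * (i : ℝ≥0∞)).toReal, ENNReal.toReal_nonneg, fun x => ?_⟩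
  have h1 : ∑' i : ℕ, D.p x i * (i : ℝ≥0∞) ≤ ⨆ x, ∑' i : ℕ, D.p x i * (i : ℝ≥0∞) :=
    le_iSup (fun x => ∑' i : ℕ, D.p x i * (i : ℝ≥0∞)) x
  have h2 := (h1.trans_lt D.sup_mean_lt_top).ne
  have h3 : (fun i : ℕ => (D.p x i).toReal * i) = fun i : ℕ => (D.p x i * (i : ℝ≥0∞)).toReal := by
    ext i; simp
  rw [h3]
  refine ⟨ENNReal.summable_toReal h2, ?_⟩
  rw [← ENNReal.tsum_toReal_eq
    (fun i => ENNReal.mul_ne_top ((D.p x).apply_ne_top i) (ENNReal.natCast_ne_top i))]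
  exact ENNReal.toReal_mono D.sup_mean_lt_top.ne h1

lemma pow_sub_pow_le {a b : ℝ} (ha : a ∈ Set.Icc (0 : ℝ) 1) (hb : b ∈ Set.Icc (0 : ℝ) 1)
    (hab : a ≤ b) (i : ℕ) : b ^ i - a ^ i ≤ i * (b - a) := by
  induction i with
  | zero => simp
  | succ n ih =>
    have h1 : b ^ n ≤ 1 := pow_le_one₀ hb.1 hb.2
    have h2 : 0 ≤ b ^ n := pow_nonneg hb.1 n
    have h4 : a ^ n ≤ b ^ n := pow_le_pow_left₀ ha.1 hab n
    have : b ^ (n + 1) - a ^ (n + 1) = b ^ n * (b - a) + a * (b ^ n - a ^ n) := by ring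
    rw [this]
    push_cast
    nlinarith [mul_le_mul_of_nonneg_right h1 (sub_nonneg.2 hab),
      mul_le_mul_of_nonneg_right ha.2 (sub_nonneg.2 h4)]

lemma g_mono (x : Life) {a b : ℝ} (ha : a ∈ Set.Icc (0 : ℝ) 1) (hb : b ∈ Set.Icc (0 : ℝ) 1)
    (hab : a ≤ b) : D.g x a ≤ D.g x b :=
  (D.g_summable x ha).tsum_le_tsum
    (fun i => mul_le_mul_of_nonneg_left (pow_le_pow_left₀ ha.1 hab i) ENNReal.toReal_nonneg)
    (D.g_summable x hb)

lemma g_lip {m : ℝ} (hm : ∀ x, Summable (fun i : ℕ => (D.p x i).toReal * i) ∧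
      ∑' i : ℕ, (D.p x i).toReal * i ≤ m) (x : Life) {a b : ℝ} (ha : a ∈ Set.Icc (0 : ℝ) 1)
    (hb : b ∈ Set.Icc (0 : ℝ) 1) (hab : a ≤ b) : D.g x b - D.g x a ≤ m * (b - a) := by
  unfold g
  rw [← (D.g_summable x hb).tsum_sub (D.g_summable x ha)]
  calc ∑' i : ℕ, ((D.p x i).toReal * b ^ i - (D.p x i).toReal * a ^ i)
      ≤ ∑' i : ℕ, (D.p x i).toReal * i * (b - a) := by
        refine Summable.tsum_le_tsum (fun i => ?_)
          ((D.g_summable x hb).sub (D.g_summable x ha)) ((hm x).1.mul_right _)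
        rw [← mul_sub, mul_assoc]
        exact mul_le_mul_of_nonneg_left (pow_sub_pow_le ha hb hab i) ENNReal.toReal_nonneg
    _ = (∑' i : ℕ, (D.p x i).toReal * i) * (b - a) := tsum_mul_right
    _ ≤ m * (b - a) := mul_le_mul_of_nonneg_right (hm x).2 (sub_nonneg.2 hab)

lemma g_nonneg (x : Life) {a : ℝ} (ha : a ∈ Set.Icc (0 : ℝ) 1) : 0 ≤ D.g x a :=
  tsum_nonneg fun i => mul_nonneg ENNReal.toReal_nonneg (pow_nonneg ha.1 i)

lemma g_le_one (x : Life) {a : ℝ} (ha : a ∈ Set.Icc (0 : ℝ) 1) : D.g x a ≤ 1 := by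
  refine (D.g_mono x ha ⟨zero_le_one, le_rfl⟩ ha.2).trans ?_
  simp [g, (D.p_hasSum x).tsum_eq]

/-- The integrand of the cumulant equation. -/
def rate (y z : ℝ) : ℝ := zext D.α y * (1 - zext (fun w => D.g w z) y)

lemma rate_of_pos {y : ℝ} (hy : y ∈ Set.Ioi (0 : ℝ)) (z : ℝ) :
    D.rate y z = D.α ⟨y, hy⟩ * (1 - D.g ⟨y, hy⟩ z) := by
  have hy' : 0 < y := hy
  simp [rate, zext, hy']

lemma rate_of_not_pos {y : ℝ} (hy : ¬ y ∈ Set.Ioi (0 : ℝ)) (z : ℝ) : D.rate y z = 0 := by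
  have hy' : ¬ 0 < y := hy
  simp [rate, zext, hy']

lemma rate_nonneg (y : ℝ) {z : ℝ} (hz : z ∈ Set.Icc (0 : ℝ) 1) : 0 ≤ D.rate y z := by
  by_cases hy : y ∈ Set.Ioi (0 : ℝ)
  · rw [D.rate_of_pos hy]
    exact mul_nonneg (D.α_c1.nonneg _) (sub_nonneg.2 (D.g_le_one _ hz))
  · rw [D.rate_of_not_pos hy]

lemma exists_rate_bound : ∃ A : ℝ, 0 ≤ A ∧ ∀ y z, z ∈ Set.Icc (0 : ℝ) 1 → D.rate y z ≤ A := by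
  obtain ⟨A, hA⟩ := D.α_c1.bdd
  refine ⟨max A 0, le_max_right _ _, fun y z hz => ?_⟩
  by_cases hy : y ∈ Set.Ioi (0 : ℝ)
  · rw [D.rate_of_pos hy]
    refine (mul_le_of_le_one_right (D.α_c1.nonneg _) ?_).trans ((hA _).trans (le_max_left _ _))
    linarith [D.g_nonneg ⟨y, hy⟩ hz]
  · rw [D.rate_of_not_pos hy]; exact le_max_right _ _

lemma rate_anti (y : ℝ) {a b : ℝ} (ha : a ∈ Set.Icc (0 : ℝ) 1) (hb : b ∈ Set.Icc (0 : ℝ) 1)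
    (hab : a ≤ b) : D.rate y b ≤ D.rate y a := by
  by_cases hy : y ∈ Set.Ioi (0 : ℝ)
  · rw [D.rate_of_pos hy, D.rate_of_pos hy]
    exact mul_le_mul_of_nonneg_left (sub_le_sub_left (D.g_mono _ ha hb hab) _) (D.α_c1.nonneg _)
  · rw [D.rate_of_not_pos hy, D.rate_of_not_pos hy]

lemma exists_rate_lip : ∃ C : ℝ, 0 ≤ C ∧ ∀ y a b, a ∈ Set.Icc (0 : ℝ) 1 → b ∈ Set.Icc (0 : ℝ) 1 →
    |D.rate y a - D.rate y b| ≤ C * |a - b| := by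
  obtain ⟨A, hA⟩ := D.α_c1.bdd
  obtain ⟨m, hm0, hm⟩ := D.exists_mean_bound
  have hC : 0 ≤ max A 0 * m := mul_nonneg (le_max_right _ _) hm0
  have key : ∀ y a b, a ∈ Set.Icc (0 : ℝ) 1 → b ∈ Set.Icc (0 : ℝ) 1 → a ≤ b →
      |D.rate y a - D.rate y b| ≤ max A 0 * m * |a - b| := by
    intro y a b ha hb hab
    rw [abs_of_nonneg (sub_nonneg.2 (D.rate_anti y ha hb hab)), abs_sub_comm,
      abs_of_nonneg (sub_nonneg.2 hab)]
    by_cases hy : y ∈ Set.Ioi (0 : ℝ)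
    · rw [D.rate_of_pos hy, D.rate_of_pos hy, ← mul_sub, mul_assoc]
      refine mul_le_mul ((hA _).trans (le_max_left _ _)) ?_ ?_ (le_max_right _ _)
      · linarith [D.g_lip hm ⟨y, hy⟩ ha hb hab]
      · linarith [D.g_mono ⟨y, hy⟩ ha hb hab]
    · rw [D.rate_of_not_pos hy, D.rate_of_not_pos hy, sub_zero]
      exact mul_nonneg hC (sub_nonneg.2 hab)
  refine ⟨max A 0 * m, hC, fun y a b ha hb => ?_⟩
  rcases le_total a b with h | h
  · exact key y a b ha hb h
  · rw [abs_sub_comm, abs_sub_comm a b]; exact key y b a hb ha h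

lemma measurable_rate {Ω : Type*} [MeasurableSpace Ω] {y z : Ω → ℝ} (hy : Measurable y)
    (hz : Measurable z) (hz' : ∀ ω, z ω ∈ Set.Icc (0 : ℝ) 1) :
    Measurable fun ω => D.rate (y ω) (z ω) := by
  have h1 : Measurable fun ω => zext D.α (y ω) :=
    (measurable_zext (IsC1BddPos_measurable D.α_c1)).comp hy
  have h2 : Measurable fun ω => zext (fun w => D.g w (z ω)) (y ω) := by
    refine measurable_of_tendsto_metrizable
      (f := fun n ω => ∑ i ∈ Finset.range n, zext (fun w => (D.p w i).toReal) (y ω) * z ω ^ i)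
      (fun n => ?_) (tendsto_pi_nhds.2 fun ω => ?_)
    · exact Finset.measurable_sum _ fun i _ =>
        ((measurable_zext (IsC1BddPos_measurable (D.p_c1 i))).comp hy).mul (hz.pow_const i)
    · by_cases h : y ω ∈ Set.Ioi (0 : ℝ)
      · have h' : 0 < y ω := h
        simpa [zext, h', g] using (D.g_summable ⟨y ω, h⟩ (hz' ω)).hasSum.tendsto_sum_nat
      · have h' : ¬ 0 < y ω := h
        simp [zext, h']
  exact h1.mul (measurable_const.sub h2)

/-- `⟨G, exp(-u_t)⟩`. -/
def expG (u : ℝ≥0 → Life → ℝ) (t : ℝ≥0) : ℝ := ∫ z, Real.exp (-u t z) ∂D.G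

section
variable {u v : ℝ≥0 → Life → ℝ}

lemma integrable_exp (hu : Measurable (Function.uncurry u)) (hu0 : ∀ t x, 0 ≤ u t x) (t : ℝ≥0) :
    Integrable (fun z => Real.exp (-u t z)) D.G := by
  have hm : Measurable (u t) := hu.comp measurable_prodMk_left
  refine Integrable.of_bound (C := 1) (Real.measurable_exp.comp hm.neg).aestronglyMeasurable
    (Eventually.of_forall fun z => ?_)
  rw [Real.norm_eq_abs, Real.abs_exp]
  exact Real.exp_le_one_iff.2 (neg_nonpos.2 (hu0 t z))

lemma expG_mem (hu : Measurable (Function.uncurry u)) (hu0 : ∀ t x, 0 ≤ u t x) (t : ℝ≥0) :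
    D.expG u t ∈ Set.Icc (0 : ℝ) 1 := by
  refine ⟨integral_nonneg fun z => (Real.exp_pos _).le, ?_⟩
  calc D.expG u t ≤ ∫ _, (1 : ℝ) ∂D.G :=
        integral_mono (D.integrable_exp hu hu0 t) (integrable_const _)
          (fun z => Real.exp_le_one_iff.2 (neg_nonpos.2 (hu0 t z)))
    _ = 1 := by simp

lemma measurable_expG (hu : Measurable (Function.uncurry u)) : Measurable (D.expG u) := by
  have h : StronglyMeasurable (Function.uncurry fun t z => Real.exp (-u t z)) :=
    (Real.measurable_exp.comp hu.neg).stronglyMeasurable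
  exact h.integral_prod_right.measurable

end

/-- The right-hand side of the cumulant equation. -/
def rhs (f : BPos) (q : ℝ≥0 → ℝ) (t : ℝ≥0) (x : Life) : ℝ :=
  zext f.toFun (x - t) + ∫ s in (0 : ℝ)..t, D.rate (x - s) (q (t - s).toNNReal)

section
variable {q q' : ℝ≥0 → ℝ}

lemma intervalIntegrable_rate (hq : Measurable q) (hq' : ∀ t, q t ∈ Set.Icc (0 : ℝ) 1)
    (t : ℝ≥0) (x : Life) :
    IntervalIntegrable (fun s => D.rate (x - s) (q (t - s).toNNReal)) volume 0 t := by
  obtain ⟨A, hA0, hA⟩ := D.exists_rate_bound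
  have hm : Measurable fun s : ℝ => D.rate (x - s) (q (t - s).toNNReal) :=
    D.measurable_rate (by fun_prop)
      (hq.comp (measurable_real_toNNReal.comp (by fun_prop))) (fun s => hq' _)
  refine (intervalIntegrable_const (c := A)).mono_fun hm.aestronglyMeasurable
    (Eventually.of_forall fun s => ?_)
  beta_reduce
  rw [Real.norm_of_nonneg (D.rate_nonneg _ (hq' _)), Real.norm_of_nonneg hA0]
  exact hA _ _ (hq' _)

lemma zext_nonneg (f : BPos) (y : ℝ) : 0 ≤ zext f.toFun y := by
  unfold zext; split_ifs
  · exact f.nonneg _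
  · exact le_rfl

lemma rhs_nonneg (f : BPos) (hq' : ∀ t, q t ∈ Set.Icc (0 : ℝ) 1) (t : ℝ≥0) (x : Life) :
    0 ≤ D.rhs f q t x :=
  add_nonneg (zext_nonneg f _)
    (intervalIntegral.integral_nonneg t.coe_nonneg fun _ _ => D.rate_nonneg _ (hq' _))

lemma measurable_rhs (f : BPos) (hq : Measurable q) (hq' : ∀ t, q t ∈ Set.Icc (0 : ℝ) 1) :
    Measurable (Function.uncurry (D.rhs f q)) := by
  have h1 : Measurable fun a : ℝ≥0 × Life => zext f.toFun (a.2 - a.1) :=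
    (measurable_zext f.measurable).comp (by fun_prop)
  have h2 : Measurable fun b : (ℝ≥0 × Life) × ℝ =>
      if b.2 ∈ Set.Ioc (0 : ℝ) b.1.1 then
        D.rate (b.1.2 - b.2) (q ((b.1.1 : ℝ) - b.2).toNNReal) else 0 := by
    refine Measurable.ite ?_ (D.measurable_rate (by fun_prop)
      (hq.comp (measurable_real_toNNReal.comp (by fun_prop))) (fun s => hq' _)) measurable_const
    exact (measurableSet_lt measurable_const measurable_snd).inter
      (measurableSet_le measurable_snd (by fun_prop))
  have h3 := h2.stronglyMeasurable.integral_prod_right' (ν := (volume : Measure ℝ))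
  have h4 : Function.uncurry (D.rhs f q) = fun a : ℝ≥0 × Life => zext f.toFun (a.2 - a.1) +
      ∫ s, if s ∈ Set.Ioc (0 : ℝ) a.1 then
        D.rate (a.2 - s) (q ((a.1 : ℝ) - s).toNNReal) else 0 := by
    ext ⟨t, x⟩
    simp only [Function.uncurry, rhs]
    rw [intervalIntegral.integral_of_le t.coe_nonneg, ← integral_indicator measurableSet_Ioc]
    simp only [Set.indicator]
  rw [h4]
  exact h1.add h3.measurable

lemma rhs_anti (f : BPos) (hq : Measurable q) (hq1 : ∀ t, q t ∈ Set.Icc (0 : ℝ) 1)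
    (hr : Measurable q') (hr1 : ∀ t, q' t ∈ Set.Icc (0 : ℝ) 1) (h : ∀ t, q t ≤ q' t)
    (t : ℝ≥0) (x : Life) : D.rhs f q' t x ≤ D.rhs f q t x :=
  add_le_add_right (intervalIntegral.integral_mono_on t.coe_nonneg (D.intervalIntegrable_rate hr hr1 t x)
    (D.intervalIntegrable_rate hq hq1 t x)
    (fun _ _ => D.rate_anti _ (hq1 _) (hr1 _) (h _))) _

lemma exists_rhs_bound (f : BPos) (t : ℝ≥0) : ∃ K : ℝ, ∀ s ≤ t, ∀ x, ∀ q : ℝ≥0 → ℝ,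
    Measurable q → (∀ t, q t ∈ Set.Icc (0 : ℝ) 1) → D.rhs f q s x ≤ K := by
  obtain ⟨A, hA0, hA⟩ := D.exists_rate_bound
  obtain ⟨F, hF⟩ := f.bdd
  refine ⟨max F 0 + A * t, fun s hs x q hq hq' => add_le_add ?_ ?_⟩
  · unfold zext; split_ifs
    · exact (hF _).trans (le_max_left _ _)
    · exact le_max_right _ _
  · calc ∫ r in (0 : ℝ)..s, D.rate (x - r) (q (s - r).toNNReal)
        ≤ ∫ _ in (0 : ℝ)..s, A := intervalIntegral.integral_mono_on s.2
          (D.intervalIntegrable_rate hq hq' s x) intervalIntegrable_const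
          (fun _ _ => hA _ _ (hq' _))
      _ = A * s := by simp [mul_comm]
      _ ≤ A * t := mul_le_mul_of_nonneg_left (by exact_mod_cast hs) hA0

end

lemma IsCumulant.eq_rhs {D : BranchingParams} {f : BPos} {u : ℝ≥0 → Life → ℝ}
    (h : D.IsCumulant f u) (t : ℝ≥0) (x : Life) : u t x = D.rhs f (D.expG u) t x :=
  h.eqn t x

/-- Picard iterates of the cumulant equation. -/
def picard (f : BPos) : ℕ → ℝ≥0 → Life → ℝ
  | 0 => fun _ _ => 0
  | n + 1 => D.rhs f (D.expG (picard f n))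

lemma picard_prop (f : BPos) (n : ℕ) : Measurable (Function.uncurry (D.picard f n)) ∧
    ∀ t x, 0 ≤ D.picard f n t x := by
  induction n with
  | zero => exact ⟨measurable_const, fun _ _ => le_rfl⟩
  | succ n ih =>
    exact ⟨D.measurable_rhs f (D.measurable_expG ih.1) (D.expG_mem ih.1 ih.2),
      D.rhs_nonneg f (D.expG_mem ih.1 ih.2)⟩

lemma expG_anti {u v : ℝ≥0 → Life → ℝ} (hu : Measurable (Function.uncurry u))
    (hu0 : ∀ t x, 0 ≤ u t x) (hv : Measurable (Function.uncurry v)) (hv0 : ∀ t x, 0 ≤ v t x)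
    (h : ∀ t x, u t x ≤ v t x) (t : ℝ≥0) : D.expG v t ≤ D.expG u t :=
  integral_mono (D.integrable_exp hv hv0 t) (D.integrable_exp hu hu0 t)
    fun z => Real.exp_le_exp.2 (neg_le_neg (h t z))

lemma picard_mono (f : BPos) (n : ℕ) (t : ℝ≥0) (x : Life) :
    D.picard f n t x ≤ D.picard f (n + 1) t x := by
  induction n generalizing t x with
  | zero => exact (D.picard_prop f 1).2 t x
  | succ n ih =>
    have h1 := D.picard_prop f n
    have h2 := D.picard_prop f (n + 1)
    exact D.rhs_anti f (D.measurable_expG h2.1) (D.expG_mem h2.1 h2.2) (D.measurable_expG h1.1)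
      (D.expG_mem h1.1 h1.2) (D.expG_anti h1.1 h1.2 h2.1 h2.2 ih) t x

lemma exists_isCumulant (f : BPos) : ∃ u, D.IsCumulant f u := by
  have hmono : ∀ t x, Monotone fun n => D.picard f n t x := fun t x =>
    monotone_nat_of_le_succ fun n => D.picard_mono f n t x
  have hbdd : ∀ t x, BddAbove (Set.range fun n => D.picard f n t x) := by
    intro t x
    obtain ⟨K, hK⟩ := D.exists_rhs_bound f t
    refine ⟨max K 0, ?_⟩
    rintro _ ⟨n, rfl⟩
    cases n with
    | zero => exact le_max_right _ _
    | succ n =>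
      have h := D.picard_prop f n
      exact (hK t le_rfl x _ (D.measurable_expG h.1) (D.expG_mem h.1 h.2)).trans (le_max_left _ _)
  let u : ℝ≥0 → Life → ℝ := fun t x => ⨆ n, D.picard f n t x
  have hlim : ∀ t x, Tendsto (fun n => D.picard f n t x) atTop (𝓝 (u t x)) := fun t x =>
    tendsto_atTop_ciSup (hmono t x) (hbdd t x)
  have hum : Measurable (Function.uncurry u) :=
    measurable_of_tendsto_metrizable (fun n => (D.picard_prop f n).1)
      (tendsto_pi_nhds.2 fun a => hlim a.1 a.2)
  have hu0 : ∀ t x, 0 ≤ u t x := fun t x =>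
    ge_of_tendsto' (hlim t x) fun n => (D.picard_prop f n).2 t x
  have hG : ∀ t, Tendsto (fun n => D.expG (D.picard f n) t) atTop (𝓝 (D.expG u t)) := by
    intro t
    refine tendsto_integral_of_dominated_convergence (fun _ => (1 : ℝ))
      (fun n => (D.integrable_exp (D.picard_prop f n).1
        (D.picard_prop f n).2 t).aestronglyMeasurable) (integrable_const _)
      (fun n => Eventually.of_forall fun z => ?_) (Eventually.of_forall fun z => ?_)
    · rw [Real.norm_eq_abs, Real.abs_exp]
      exact Real.exp_le_one_iff.2 (neg_nonpos.2 ((D.picard_prop f n).2 t z))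
    · exact (Real.continuous_exp.tendsto _).comp (hlim t z).neg
  obtain ⟨A, hA0, hA⟩ := D.exists_rate_bound
  obtain ⟨C, hC0, hC⟩ := D.exists_rate_lip
  refine ⟨u, hum, hu0, fun t x => ?_⟩
  have h1 : Tendsto (fun n => D.picard f (n + 1) t x) atTop (𝓝 (D.rhs f (D.expG u) t x)) := by
    refine tendsto_const_nhds.add
      (intervalIntegral.tendsto_integral_filter_of_dominated_convergence (fun _ => A)
        (Eventually.of_forall fun n => ?_) (Eventually.of_forall fun n =>
          Eventually.of_forall fun s _ => ?_) intervalIntegrable_const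
        (Eventually.of_forall fun s _ => ?_))
    · have h := D.picard_prop f n
      exact (D.measurable_rate (by fun_prop) ((D.measurable_expG h.1).comp
        (measurable_real_toNNReal.comp (by fun_prop)))
        (fun s => D.expG_mem h.1 h.2 _)).aestronglyMeasurable
    · have h := D.expG_mem (D.picard_prop f n).1 (D.picard_prop f n).2 (t - s).toNNReal
      rw [Real.norm_of_nonneg (D.rate_nonneg _ h)]
      exact hA _ _ h
    · rw [tendsto_iff_dist_tendsto_zero]
      have h3 := ((tendsto_iff_dist_tendsto_zero.1 (hG (t - s).toNNReal)).const_mul C)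
      rw [mul_zero] at h3
      refine squeeze_zero (fun _ => dist_nonneg) (fun n => ?_) h3
      exact hC _ _ _ (D.expG_mem (D.picard_prop f n).1 (D.picard_prop f n).2 _)
        (D.expG_mem hum hu0 _)
  exact tendsto_nhds_unique ((hlim t x).comp (tendsto_add_atTop_nat 1)) h1

lemma isCumulant_unique {f : BPos} {u v : ℝ≥0 → Life → ℝ} (hu : D.IsCumulant f u)
    (hv : D.IsCumulant f v) : u = v := by
  obtain ⟨C, hC0, hC⟩ := D.exists_rate_lip
  have hqu := D.expG_mem hu.measurable hu.nonneg
  have hqv := D.expG_mem hv.measurable hv.nonneg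
  have hmu := D.measurable_expG hu.measurable
  have hmv := D.measurable_expG hv.measurable
  let d : ℝ → ℝ := fun s => |D.expG u s.toNNReal - D.expG v s.toNNReal|
  have hd0 : ∀ s, 0 ≤ d s := fun s => abs_nonneg _
  have hd1 : ∀ s, d s ≤ 1 := fun s => by
    have a := hqu s.toNNReal
    have b := hqv s.toNNReal
    exact abs_sub_le_iff.2 ⟨by linarith [a.2, b.1], by linarith [b.2, a.1]⟩
  have hdm : Measurable d :=
    ((hmu.comp measurable_real_toNNReal).sub (hmv.comp measurable_real_toNNReal)).abs
  have hdi : ∀ a b, IntervalIntegrable d volume a b := fun a b =>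
    (intervalIntegrable_const (c := (1 : ℝ))).mono_fun hdm.aestronglyMeasurable
      (Eventually.of_forall fun s => by
        beta_reduce
        rw [Real.norm_of_nonneg (hd0 s)]; simpa using hd1 s)
  have hdiff : ∀ (t : ℝ≥0) (x : Life), |u t x - v t x| ≤ C * ∫ s in (0 : ℝ)..t, d s := by
    intro t x
    have e1 := hu.eq_rhs t x
    have e2 := hv.eq_rhs t x
    have e3 : u t x - v t x = ∫ s in (0 : ℝ)..t,
        (D.rate (x - s) (D.expG u (t - s).toNNReal) -
          D.rate (x - s) (D.expG v (t - s).toNNReal)) := by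
      rw [intervalIntegral.integral_sub (D.intervalIntegrable_rate hmu hqu t x)
        (D.intervalIntegrable_rate hmv hqv t x), e1, e2]
      simp only [rhs]; ring
    have e4 : ∫ s in (0 : ℝ)..t, d s = ∫ s in (0 : ℝ)..t, d (t - s) := by
      rw [intervalIntegral.integral_comp_sub_left]; simp
    rw [e3, e4, ← intervalIntegral.integral_const_mul, ← Real.norm_eq_abs]
    refine intervalIntegral.norm_integral_le_of_norm_le t.coe_nonneg
      (Eventually.of_forall fun s _ => hC _ _ _ (hqu _) (hqv _)) ?_
    have := ((hdi (t - 0) (t - t)).comp_sub_left (t : ℝ)).const_mul C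
    simpa using this
  have hdd : ∀ t : ℝ≥0, d t ≤ C * ∫ s in (0 : ℝ)..t, d s := by
    intro t
    have hi1 := D.integrable_exp hu.measurable hu.nonneg t
    have hi2 := D.integrable_exp hv.measurable hv.nonneg t
    have e : d t = ‖∫ z, (Real.exp (-u t z) - Real.exp (-v t z)) ∂D.G‖ := by
      rw [integral_sub hi1 hi2, Real.norm_eq_abs]
      simp [d, expG]
    rw [e]
    refine (norm_integral_le_of_norm_le_const (C := C * ∫ s in (0 : ℝ)..t, d s)
      (Eventually.of_forall fun z => ?_)).trans_eq (by simp)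
    refine le_trans ?_ (hdiff t z)
    have key : ∀ a b : ℝ, 0 ≤ a → a ≤ b → |Real.exp (-a) - Real.exp (-b)| ≤ |a - b| := by
      intro a b ha hab
      rw [abs_of_nonneg (sub_nonneg.2 (Real.exp_le_exp.2 (neg_le_neg hab))),
        abs_sub_comm, abs_of_nonneg (sub_nonneg.2 hab)]
      have h1 : Real.exp (-b) = Real.exp (-a) * Real.exp (-(b - a)) := by
        rw [← Real.exp_add]; ring_nf
      have h2 := Real.add_one_le_exp (-(b - a))
      have h3 : Real.exp (-a) ≤ 1 := Real.exp_le_one_iff.2 (neg_nonpos.2 ha)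
      have h4 := Real.exp_pos (-a)
      rw [h1]
      nlinarith
    rw [Real.norm_eq_abs]
    rcases le_total (u t z) (v t z) with h | h
    · exact key _ _ (hu.nonneg t z) h
    · rw [abs_sub_comm, abs_sub_comm (u t z)]; exact key _ _ (hv.nonneg t z) h
  have hpow : ∀ (n : ℕ) (t : ℝ≥0), d t ≤ (C * t) ^ n / n.factorial := by
    intro n
    induction n with
    | zero => intro t; simpa using hd1 t
    | succ n ih =>
      intro t
      refine (hdd t).trans ?_
      have h1 : ∫ s in (0 : ℝ)..t, d s ≤ ∫ s in (0 : ℝ)..t, (C ^ n / n.factorial) * s ^ n := by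
        refine intervalIntegral.integral_mono_on t.coe_nonneg (hdi _ _)
          (Continuous.intervalIntegrable (by fun_prop) _ _) fun s hs => ?_
        have := ih ⟨s, hs.1⟩
        refine this.trans_eq ?_
        change (C * s) ^ n / _ = _
        rw [mul_pow]; ring
      refine (mul_le_mul_of_nonneg_left h1 hC0).trans_eq ?_
      rw [intervalIntegral.integral_const_mul, integral_pow, Nat.factorial_succ]
      push_cast
      field_simp
      simp
      ring
  have hzero : ∀ t : ℝ≥0, d t = 0 := fun t =>
    le_antisymm (ge_of_tendsto' (FloorSemiring.tendsto_pow_div_factorial_atTop (C * t))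
      fun n => hpow n t) (hd0 t)
  funext t x
  have h0 : ∫ s in (0 : ℝ)..t, d s = 0 := by
    rw [intervalIntegral.integral_congr (g := fun _ => (0 : ℝ))]
    · simp
    · intro s hs
      rw [Set.uIcc_of_le t.coe_nonneg] at hs
      exact hzero ⟨s, hs.1⟩
  have := hdiff t x
  rw [h0, mul_zero] at this
  exact sub_eq_zero.1 (abs_nonpos_iff.1 this)

theorem existsUnique_isCumulant (f : BPos) : ∃! u, D.IsCumulant f u :=
  let ⟨u, hu⟩ := D.exists_isCumulant f
  ⟨u, hu, fun _ hv => D.isCumulant_unique hv hu⟩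

/-- `(t, x) ↦ u_t f(x)`, the unique solution of the cumulant equation. -/
def cumulant (f : BPos) : ℝ≥0 → Life → ℝ := (D.existsUnique_isCumulant f).choose

theorem cumulant_spec (f : BPos) : D.IsCumulant f (D.cumulant f) :=
  (D.existsUnique_isCumulant f).choose_spec.1

/-- `s ↦ ∫_s^∞ α(x - s) g'(x - s, 1-) G(dx)`. -/
def birthDensity (s : ℝ) : ℝ≥0∞ :=
  ∫⁻ x in {x : Life | s < x}, ENNReal.ofReal (zext D.α (x - s) * zext D.mean (x - s)) ∂D.G

end BranchingParams

/-- The functional `ψ(f) = ∫ (1 - exp(-⟨ν, f⟩)) L(dν)`. -/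
def psi (L : Measure NonzeroIntMeasure) (f : Life → ℝ) : ℝ :=
  ∫ ν, (1 - Real.exp (-ν.1.pair f)) ∂L

/-- `P` is the transition semigroup of the branching process with immigration with parameters
`(α, g, G, ψ)`: for every `t` and `σ`, `P_t(σ, ·)` is the probability measure on `𝔑(0, ∞)` with
Laplace functional `f ↦ exp(-⟨σ, u_t f⟩ - ∫_0^t ψ(u_s f) ds)`, `f ∈ B(0, ∞)⁺`. The Laplace functionals determine
`P`, so the semigroup property is a consequence and is not assumed. -/
structure IsImmigrationSemigroup (D : BranchingParams) (L : Measure NonzeroIntMeasure)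
    (P : ℝ≥0 → Kernel IntMeasure IntMeasure) : Prop where
  isMarkovKernel : ∀ t, IsMarkovKernel (P t)
  laplace : ∀ (t : ℝ≥0) (σ : IntMeasure) (f : BPos),
    ∫ ν, Real.exp (-ν.pair f.toFun) ∂(P t σ) =
      Real.exp (-σ.pair (D.cumulant f t)
        - ∫ s in (0 : ℝ)..t, psi L (D.cumulant f s.toNNReal))

/-- The transition law `P_t(σ, ·)` as a point of the space of probability measures on `𝔑(0, ∞)`
with the topology of weak convergence. -/
def IsImmigrationSemigroup.law {D : BranchingParams} {L : Measure NonzeroIntMeasure}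
    {P : ℝ≥0 → Kernel IntMeasure IntMeasure} (hP : IsImmigrationSemigroup D L P)
    (t : ℝ≥0) (σ : IntMeasure) : ProbabilityMeasure IntMeasure :=
  ⟨P t σ, (hP.isMarkovKernel t).isProbabilityMeasure σ⟩

/-- Upper Riemann sum `∑_{n ≥ 1} a M_n(a)` of a nonnegative function on `[0, ∞)`. -/
def upperSum (h : ℝ → ℝ) (a : ℝ) : ℝ≥0∞ :=
  ∑' n : ℕ, ENNReal.ofReal a * ⨆ x ∈ Set.Icc (n * a) ((n + 1) * a), ENNReal.ofReal (h x)

/-- Lower Riemann sum `∑_{n ≥ 1} a m_n(a)` of a nonnegative function on `[0, ∞)`. -/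
def lowerSum (h : ℝ → ℝ) (a : ℝ) : ℝ≥0∞ :=
  ∑' n : ℕ, ENNReal.ofReal a * ⨅ x ∈ Set.Icc (n * a) ((n + 1) * a), ENNReal.ofReal (h x)

/-- Direct Riemann integrability over `[0, ∞)` of a function that is nonnegative there. -/
structure IsDirectlyRiemannIntegrable (h : ℝ → ℝ) : Prop where
  nonneg : ∀ x, 0 ≤ x → 0 ≤ h x
  upper_lt_top : ∀ a, 0 < a → upperSum h a < ⊤
  lim_eq : ∃ l : ℝ≥0∞, Tendsto (upperSum h) (𝓝[>] 0) (𝓝 l) ∧ Tendsto (lowerSum h) (𝓝[>] 0) (𝓝 l)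

/-- Subcriticality together with the Cramér-type condition with exponent `α₁`. -/
structure SubcriticalCramer (D : BranchingParams) (α₁ : ℝ) : Prop where
  subcritical : ∫⁻ s in Set.Ioi (0 : ℝ), D.birthDensity s < 1
  pos : 0 < α₁
  dri : IsDirectlyRiemannIntegrable
    fun t => Real.exp (α₁ * t) * (1 - D.G.real {x : Life | (x : ℝ) ≤ t})
  cramer : ∫⁻ s in Set.Ioi (0 : ℝ), ENNReal.ofReal (Real.exp (α₁ * s)) * D.birthDensity s = 1

end AgeBranching

end

open AgeBranching

/-! The cumulant equation feeds `u` back only through the scalar function `t ↦ ⟨G, exp(-u_t f)⟩`, so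
two cumulants `u f` and `u h` are compared through `gap`, the distance of these scalars. Since `g(x,
·)` has Lipschitz constant `g'(x, 1-)`, subtracting the two equations and integrating against `G`
gives a renewal inequality for `gap` whose kernel is exactly `birthDensity`. By (i) this kernel has
mass `ρ < 1`, so `gap` is integrable over all time, with integral at most `(1 - ρ)⁻¹ ∫ travel |f -
h| dG` (`lintegral_le_of_renewal_ineq`, `lintegral_gap_le`). The right side is finite because (ii)
gives `G` a finite mean.

Put back into the equation, this bounds `∫ |u_t f(x) - u_t h(x)| dt` by `travel |f - h| (x)` plus a
multiple of `x`. Integration against the intensity of the immigrants, which has a finite first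
moment by (iii), then bounds `∫ |ψ(u_s f) - ψ(u_s h)| ds`. `exists_measure_control` puts all this
into one measure `N` with finite first moment: every error is at most `∫ travel |f - h| dN`. Taking
`h = 0` makes the limiting exponent finite; dominated convergence makes it continuous under bounded
pointwise limits; and test functions `f` that detect large mass, or mass outside a compact set, give
tightness.

A finite integer-valued `σ` has bounded support, so after some time only its descendants count, and
their contribution is bounded by a tail of `∫ gap`. Hence the Laplace functionals of `P_t(σ, ·)`
converge to a limit that does not depend on `σ`.

Weak convergence follows by compactness. Laws with prescribed tail bounds along `compacts` form a
compact set, and limit points are identified because the functions `ν ↦ exp(-⟨ν, f⟩)`, `f`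
continuous, span an algebra that separates points. The formula for `η` then passes from continuous
to Borel `f` along the bounded Baire class. -/

namespace AgeBranching

open BoundedContinuousFunction

/-! ### Bounded Borel functions as iterated bounded limits of continuous functions -/

section Baire

variable {X : Type*} [TopologicalSpace X]

/-- The smallest class of real functions that contains the bounded continuous ones and is closed
under bounded pointwise limits of sequences. -/
inductive IsBddBaire : (X → ℝ) → Prop
  | cont (f : X →ᵇ ℝ) : IsBddBaire f
  | lim (F : ℕ → X → ℝ) (f : X → ℝ) (K : ℝ) (hF : ∀ n, IsBddBaire (F n))
      (hK : ∀ n x, |F n x| ≤ K) (hf : ∀ x, Tendsto (fun n => F n x) atTop (𝓝 (f x))) :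
      IsBddBaire f

lemma IsBddBaire.exists_bound {f : X → ℝ} (hf : IsBddBaire f) : ∃ K : ℝ, ∀ x, |f x| ≤ K := by
  induction hf with
  | cont f => exact ⟨‖f‖, fun x => f.norm_coe_le_norm x⟩
  | lim F f K _ hK hf _ => exact ⟨K, fun x => le_of_tendsto' (hf x).abs fun n => hK n x⟩

/-- Nested induction, taking limits in one summand with the other fixed; a bound for the fixed
summand keeps the sums uniformly bounded. -/
lemma IsBddBaire.add {f g : X → ℝ} (hf : IsBddBaire f) (hg : IsBddBaire g) :
    IsBddBaire (f + g) := by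
  induction hf with
  | cont f =>
    induction hg with
    | cont g => exact .cont (f + g)
    | lim F g K hF hK hg ih =>
      refine .lim (fun n => (f : X → ℝ) + F n) _ (‖f‖ + K) ih (fun n x => ?_)
        fun x => (hg x).const_add _
      exact (abs_add_le _ _).trans (add_le_add (f.norm_coe_le_norm x) (hK n x))
  | lim F f K hF hK hf ih =>
    obtain ⟨C, hC⟩ := hg.exists_bound
    refine .lim (fun n => F n + g) _ (K + C) ih (fun n x => ?_) fun x => (hf x).add_const _
    exact (abs_add_le _ _).trans (add_le_add (hK n x) (hC x))

lemma IsBddBaire.const_smul {f : X → ℝ} (hf : IsBddBaire f) (c : ℝ) : IsBddBaire (c • f) := by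
  induction hf with
  | cont f => exact .cont (c • f)
  | lim F f K hF hK hf ih =>
    refine .lim (fun n => c • F n) _ (|c| * K) ih (fun n x => ?_) fun x => (hf x).const_smul c
    simp only [Pi.smul_apply, smul_eq_mul, abs_mul]
    exact mul_le_mul_of_nonneg_left (hK n x) (abs_nonneg c)

variable [MeasurableSpace X] [BorelSpace X] [HasOuterApproxClosed X]

/-- A π-λ argument from the closed sets: their indicators are limits of continuous functions,
complements are handled by linearity, and countable disjoint unions are limits of finite sums
bounded by `1`. -/
lemma isBddBaire_indicator {s : Set X} (hs : MeasurableSet s) :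
    IsBddBaire (s.indicator fun _ => (1 : ℝ)) := by
  have h1 : IsBddBaire (fun _ : X => (1 : ℝ)) := .cont (BoundedContinuousFunction.const X 1)
  have h0 : IsBddBaire (0 : X → ℝ) := .cont 0
  induction s, hs using MeasurableSpace.induction_on_inter
    ((BorelSpace.measurable_eq (α := X)).trans borel_eq_generateFrom_isClosed)
    isPiSystem_isClosed with
  | empty => rw [Set.indicator_empty]; exact h0
  | basic t ht =>
    have ht : IsClosed t := ht
    refine .lim (fun n x => (ht.apprSeq n x : ℝ)) _ 1 (fun n => ?_) (fun n x => ?_) fun x => ?_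
    · exact .cont ⟨⟨fun x => (ht.apprSeq n x : ℝ), by fun_prop⟩, 1, fun x y => by
        have hx : (ht.apprSeq n x : ℝ) ≤ 1 := by
          exact_mod_cast HasOuterApproxClosed.apprSeq_apply_le_one ht n x
        have hy : (ht.apprSeq n y : ℝ) ≤ 1 := by
          exact_mod_cast HasOuterApproxClosed.apprSeq_apply_le_one ht n y
        exact abs_sub_le_iff.2 ⟨by linarith [(ht.apprSeq n y).coe_nonneg],
          by linarith [(ht.apprSeq n x).coe_nonneg]⟩⟩
    · rw [abs_of_nonneg (NNReal.coe_nonneg _)]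
      exact_mod_cast HasOuterApproxClosed.apprSeq_apply_le_one ht n x
    · have h := tendsto_pi_nhds.1 (HasOuterApproxClosed.tendsto_apprSeq ht) x
      have h2 := (NNReal.continuous_coe.tendsto _).comp h
      convert! h2 using 2
      by_cases hx : x ∈ t <;> simp [hx]
  | compl t htm ih =>
    convert! h1.add (ih.const_smul (-1)) using 1
    ext x
    by_cases hx : x ∈ t <;> simp [hx]
  | iUnion A hd hm ih =>
    have hB : ∀ n, IsBddBaire ((⋃ i ∈ Finset.range n, A i).indicator fun _ => (1 : ℝ)) := by
      intro n
      have h : (⋃ i ∈ Finset.range n, A i).indicator (fun _ => (1 : ℝ)) =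
          ∑ i ∈ Finset.range n, (A i).indicator fun _ => (1 : ℝ) := by
        rw [Finset.indicator_biUnion]
        · ext y; simp
        · exact fun i _ j _ hij => hd hij
      rw [h]
      clear h
      induction n with
      | zero => simpa using h0
      | succ n ihn => rw [Finset.sum_range_succ]; exact ihn.add (ih n)
    refine .lim _ _ 1 hB (fun n x => ?_) fun x => ?_
    · by_cases hx : x ∈ ⋃ i ∈ Finset.range n, A i
      · rw [Set.indicator_of_mem hx]; simp
      · rw [Set.indicator_of_notMem hx]; simp
    · by_cases hx : x ∈ ⋃ i, A i
      · obtain ⟨j, hj⟩ := Set.mem_iUnion.1 hx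
        refine tendsto_const_nhds.congr' ?_
        filter_upwards [eventually_gt_atTop j] with n hn
        rw [Set.indicator_of_mem hx, Set.indicator_of_mem]
        exact Set.mem_biUnion (Finset.mem_coe.2 (Finset.mem_range.2 hn)) hj
      · refine tendsto_const_nhds.congr fun n => ?_
        rw [Set.indicator_of_notMem hx, Set.indicator_of_notMem]
        exact fun h => hx (Set.iUnion₂_subset_iUnion _ _ h)

/-- Every bounded Borel function is an iterated bounded pointwise limit of bounded continuous
functions. -/
theorem isBddBaire_of_measurable {f : X → ℝ} (hf : Measurable f) {K : ℝ} (hK : ∀ x, |f x| ≤ K) :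
    IsBddBaire f := by
  have hs : ∀ g : SimpleFunc X ℝ, IsBddBaire (g : X → ℝ) := by
    intro g
    induction g using SimpleFunc.induction with
    | @const c s hs =>
      convert! (isBddBaire_indicator hs).const_smul c using 1
      ext x
      by_cases hx : x ∈ s <;> simp [hx]
    | add _ ihf ihg => exact ihf.add ihg
  have hfm := hf.stronglyMeasurable
  refine .lim (fun n => hfm.approxBounded K n) f K (fun n => hs _) (fun n x => ?_) fun x => ?_
  -- A point of `X` is needed only to know that `0 ≤ K`.
  · rcases isEmpty_or_nonempty X with h | ⟨⟨x0⟩⟩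
    · exact (h.false x).elim
    exact hfm.norm_approxBounded_le ((abs_nonneg _).trans (hK x0)) n x
  · exact hfm.tendsto_approxBounded_of_norm_le (hK x)

end Baire

/-! ### The space of integer-valued measures -/

namespace IntMeasure

instance (ν : IntMeasure) : IsFiniteMeasure ν.toMeasure :=
  inferInstanceAs (IsFiniteMeasure (ν.1 : Measure Life))

instance : T2Space IntMeasure := inferInstanceAs (T2Space (Subtype _))

instance : Zero IntMeasure := ⟨⟨0, fun _ _ => ⟨0, by simp⟩⟩⟩

lemma continuous_pair (f : Life →ᵇ ℝ) : Continuous fun ν : IntMeasure => ν.pair f :=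
  (FiniteMeasure.continuous_integral_boundedContinuousFunction f).comp continuous_subtype_val

lemma integrable_of_bound (ν : IntMeasure) {f : Life → ℝ} (hf : Measurable f) {K : ℝ}
    (hK : ∀ x, |f x| ≤ K) : Integrable f ν.toMeasure :=
  Integrable.of_bound hf.aestronglyMeasurable (C := K) (Eventually.of_forall hK)

lemma pair_nonneg (ν : IntMeasure) {f : Life → ℝ} (hf : ∀ x, 0 ≤ f x) : 0 ≤ ν.pair f :=
  integral_nonneg hf

lemma tendsto_pair (ν : IntMeasure) {F : ℕ → Life → ℝ} {f : Life → ℝ} {K : ℝ}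
    (hF : ∀ n, Measurable (F n)) (hK : ∀ n x, |F n x| ≤ K)
    (hf : ∀ x, Tendsto (fun n => F n x) atTop (𝓝 (f x))) :
    Tendsto (fun n => ν.pair (F n)) atTop (𝓝 (ν.pair f)) :=
  tendsto_integral_of_dominated_convergence (fun _ => K)
    (fun n => (hF n).aestronglyMeasurable) (integrable_const K)
    (fun n => Eventually.of_forall (hK n)) (Eventually.of_forall hf)

/-- The Borel sets come from the weak topology, so measurability of the pairing is immediate only
for continuous `f`. Dominated convergence carries it along the Baire class. -/
lemma measurable_of_isBddBaire {f : Life → ℝ} (hf : IsBddBaire f) :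
    Measurable f ∧ Measurable fun ν : IntMeasure => ν.pair f := by
  induction hf with
  | cont f => exact ⟨f.continuous.measurable, (continuous_pair f).measurable⟩
  | lim F f K hF hK hf ih =>
    exact ⟨measurable_of_tendsto_metrizable (fun n => (ih n).1) (tendsto_pi_nhds.2 hf),
      measurable_of_tendsto_metrizable (fun n => (ih n).2)
        (tendsto_pi_nhds.2 fun ν => ν.tendsto_pair (fun n => (ih n).1) hK hf)⟩

lemma measurable_pair {f : Life → ℝ} (hf : Measurable f) {K : ℝ} (hK : ∀ x, |f x| ≤ K) :
    Measurable fun ν : IntMeasure => ν.pair f :=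
  (measurable_of_isBddBaire (isBddBaire_of_measurable hf hK)).2

lemma pair_indicator (ν : IntMeasure) {s : Set Life} (hs : MeasurableSet s) :
    ν.pair (s.indicator fun _ => (1 : ℝ)) = ν.toMeasure.real s := by
  simp [pair, integral_indicator hs]

/-- Evaluation at a Borel set is the pairing with its indicator. This makes an integer-valued
measure a kernel, so that joint measurability and Fubini become available. -/
lemma measurable_toMeasure : Measurable toMeasure := by
  refine Measure.measurable_of_measurable_coe _ fun s hs => ?_
  have h := (measurable_of_isBddBaire (isBddBaire_indicator hs)).2.ennreal_ofReal
  simpa [pair_indicator _ hs] using h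

lemma exists_measure_eq (ν : IntMeasure) {s : Set Life} (hs : MeasurableSet s) :
    ∃ n : ℕ, ν.toMeasure s = n := by
  obtain ⟨n, hn⟩ := ν.2 s hs
  exact ⟨n, by rw [toMeasure, ← FiniteMeasure.ennreal_coeFn_eq_coeFn_toMeasure, hn]; simp⟩

/-- The identity kernel that samples a point from an integer-valued measure. -/
noncomputable def kernel : Kernel IntMeasure Life := ⟨toMeasure, measurable_toMeasure⟩

/-- The total mass is not bounded uniformly in `ν`, but it is a natural number: splitting by its
value gives countably many finite kernels. -/
instance : IsSFiniteKernel kernel := by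
  classical
  have hm : ∀ n : ℕ, MeasurableSet {ν : IntMeasure | ν.toMeasure Set.univ = n} := fun n =>
    (Measure.measurable_coe MeasurableSet.univ).comp measurable_toMeasure (measurableSet_singleton _)
  have hfin : ∀ n, IsFiniteKernel (Kernel.piecewise (hm n) kernel 0) := fun n =>
    ⟨⟨n, ENNReal.natCast_lt_top n, fun ν => by
      by_cases h : ν ∈ {ν : IntMeasure | ν.toMeasure Set.univ = n}
      · rw [Kernel.piecewise_apply, if_pos h]; exact h.le
      · rw [Kernel.piecewise_apply, if_neg h]; simp⟩⟩
  have hsum : kernel = Kernel.sum fun n => Kernel.piecewise (hm n) kernel 0 := by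
    ext ν s hs
    obtain ⟨n, hn⟩ := ν.exists_measure_eq MeasurableSet.univ
    rw [Kernel.sum_apply, Measure.sum_apply _ hs, tsum_eq_single n]
    · rw [Kernel.piecewise_apply, if_pos (Set.mem_ofPred_eq ▸ hn)]
    · intro m hmn
      rw [Kernel.piecewise_apply, if_neg]
      · simp
      · intro h
        exact hmn (by exact_mod_cast (h.symm.trans hn))
  rw [hsum]
  infer_instance

end IntMeasure

/-! ### Compact sets of integer-valued measures -/

/-- Reduces integrality of a mass to excluding open intervals between consecutive integers, a
condition suited to weak limits. -/
lemma eq_natFloor_or_lt {r : ℝ} (hr : 0 ≤ r) : r = ⌊r⌋₊ ∨ (⌊r⌋₊ : ℝ) < r ∧ r < ⌊r⌋₊ + 1 := by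
  rcases (Nat.floor_le hr).eq_or_lt with h | h
  · exact .inl h.symm
  · exact .inr ⟨h, Nat.lt_floor_add_one r⟩

lemma not_natCast_between {m n : ℕ} (h1 : (n : ℝ) < m) (h2 : (m : ℝ) < n + 1) : False := by
  have h1 : n < m := by exact_mod_cast h1
  have h2 : m < n + 1 := by exact_mod_cast h2
  omega

section

variable {X : Type*} [MeasurableSpace X] [PseudoMetricSpace X] [BorelSpace X]

/-- Weak limits of finite integer-valued measures are integer-valued. -/
theorem isClosed_setOf_natValued :
    IsClosed {ν : FiniteMeasure X | ∀ B : Set X, MeasurableSet B → ∃ n : ℕ, ν B = n} := by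
  refine isClosed_of_closure_subset fun ν hν => ?_
  -- Suppose `n < ν F < n + 1`, and choose `δ` so that the `δ`-thickening of `F` still has mass
  -- below `n + 1`. With `E` the `δ / 2`-thickening, the thickened indicators of `F` and `E` are
  -- continuous and define a weak neighbourhood of `ν`. An integer-valued `μ` in it would satisfy `n
  -- < μ E < n + 1`.
  have hclosed : ∀ F : Set X, IsClosed F → ∃ n : ℕ, (ν : Measure X).real F = n := by
    intro F hF
    refine ⟨⌊(ν : Measure X).real F⌋₊, (eq_natFloor_or_lt measureReal_nonneg).resolve_right ?_⟩
    set n := ⌊(ν : Measure X).real F⌋₊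
    rintro ⟨h1, h2⟩
    have hlim : Tendsto (fun r => (ν : Measure X).real (Metric.thickening r F)) (𝓝[>] 0)
        (𝓝 ((ν : Measure X).real F)) :=
      (ENNReal.tendsto_toReal (measure_ne_top _ _)).comp
        (tendsto_measure_thickening_of_isClosed ⟨1, one_pos, measure_ne_top _ _⟩ hF)
    obtain ⟨δ, hδ1, hδ0⟩ := ((hlim.eventually_lt_const h2).and self_mem_nhdsWithin).exists
    have hδ0 : 0 < δ := hδ0
    have hδ : 0 < δ / 2 := half_pos hδ0
    let E := Metric.thickening (δ / 2) F
    have hi : ∀ (μ : FiniteMeasure X) (s : Set X),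
        Integrable (fun x => (thickenedIndicator hδ s x : ℝ)) (μ : Measure X) := fun μ s =>
      integrable_thickenedIndicator _ hδ
    have hc : ∀ s : Set X, Continuous fun μ : FiniteMeasure X =>
        ∫ x, (thickenedIndicator hδ s x : ℝ) ∂(μ : Measure X) := fun s =>
      FiniteMeasure.continuous_integral_boundedContinuousFunction
        (⟨⟨fun x => (thickenedIndicator hδ s x : ℝ), by fun_prop⟩,
          (thickenedIndicator hδ s).map_bounded'⟩ : X →ᵇ ℝ)
    have hind : ∀ (μ : FiniteMeasure X) {s : Set X} (_ : MeasurableSet s),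
        ∫ x, s.indicator (fun _ => (1 : ℝ)) x ∂(μ : Measure X) = (μ : Measure X).real s := by
      intro μ s hs; simp [integral_indicator hs]
    have hint : ∀ (μ : FiniteMeasure X) {s : Set X} (_ : MeasurableSet s),
        Integrable (s.indicator (fun _ => (1 : ℝ))) (μ : Measure X) := fun μ s hs =>
      (integrable_const 1).indicator hs
    have hle : ∀ (μ : FiniteMeasure X) {s : Set X} (_ : MeasurableSet s),
        (μ : Measure X).real s ≤ ∫ x, (thickenedIndicator hδ s x : ℝ) ∂(μ : Measure X) := by
      intro μ s hs
      rw [← hind μ hs]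
      refine integral_mono (hint μ hs) (hi μ s) fun x => ?_
      by_cases hx : x ∈ s
      · simp [hx, thickenedIndicator_one hδ s hx]
      · simp [hx]
    have hge : ∀ (μ : FiniteMeasure X) (s : Set X),
        ∫ x, (thickenedIndicator hδ s x : ℝ) ∂(μ : Measure X) ≤
          (μ : Measure X).real (Metric.thickening (δ / 2) s) := by
      intro μ s
      rw [← hind μ Metric.isOpen_thickening.measurableSet]
      refine integral_mono (hi μ s) (hint μ Metric.isOpen_thickening.measurableSet) fun x => ?_
      by_cases hx : x ∈ Metric.thickening (δ / 2) s
      · simpa [hx] using thickenedIndicator_le_one hδ s x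
      · simp [hx, thickenedIndicator_zero hδ s hx]
    have hEm : MeasurableSet E := Metric.isOpen_thickening.measurableSet
    have hO : IsOpen {μ : FiniteMeasure X |
        (n : ℝ) < ∫ x, (thickenedIndicator hδ F x : ℝ) ∂(μ : Measure X)
        ∧ ∫ x, (thickenedIndicator hδ E x : ℝ) ∂(μ : Measure X) < n + 1} :=
      (isOpen_lt continuous_const (hc F)).inter (isOpen_lt (hc E) continuous_const)
    obtain ⟨μ, ⟨hμ1, hμ2⟩, hμ⟩ := mem_closure_iff.1 hν _ hO
      ⟨h1.trans_le (hle ν hF.measurableSet), ((hge ν E).trans (measureReal_mono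
        ((Metric.thickening_thickening_subset _ _ _).trans_eq (by rw [add_halves])))).trans_lt hδ1⟩
    obtain ⟨m, hm⟩ := hμ E hEm
    have hm' : (μ : Measure X).real E = m := by
      have : ((μ E : ℝ≥0) : ℝ) = m := by rw [hm]; simp
      exact this
    refine not_natCast_between (m := m) (n := n) ?_ ?_
    · rw [← hm']; exact hμ1.trans_le (hge μ F)
    · rw [← hm']; exact (hle μ hEm).trans_lt hμ2
  -- Inner regularity: if `n < ν B < n + 1`, some closed `K ⊆ B` already has `ν K > n`,
  -- contradicting the closed case.
  have hborel : ∀ B : Set X, MeasurableSet B → ∃ n : ℕ, (ν : Measure X).real B = n := by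
    intro B hB
    refine ⟨⌊(ν : Measure X).real B⌋₊, (eq_natFloor_or_lt measureReal_nonneg).resolve_right ?_⟩
    set n := ⌊(ν : Measure X).real B⌋₊
    rintro ⟨h1, h2⟩
    obtain ⟨K, hKB, hK, hlt⟩ := hB.exists_isClosed_lt_add (measure_ne_top (ν : Measure X) B)
      (ε := ENNReal.ofReal ((ν : Measure X).real B - n)) (by simpa using h1)
    obtain ⟨k, hk⟩ := hclosed K hK
    have h3 : (ν : Measure X).real B < (ν : Measure X).real K + ((ν : Measure X).real B - n) := by
      have := (ENNReal.toReal_lt_toReal (measure_ne_top _ _) (by finiteness)).2 hlt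
      rwa [ENNReal.toReal_add (measure_ne_top _ _) ENNReal.ofReal_ne_top,
        ENNReal.toReal_ofReal (sub_nonneg.2 h1.le)] at this
    refine not_natCast_between (m := k) (n := n) ?_ ?_
    · rw [← hk]; linarith
    · rw [← hk]; exact (measureReal_mono hKB).trans_lt h2
  intro B hB
  obtain ⟨n, hn⟩ := hborel B hB
  refine ⟨n, NNReal.coe_injective ?_⟩
  rw [NNReal.coe_natCast, ← hn]
  rfl

end

namespace IntMeasure

/-- The integer-valued measures of mass at most `C` that are carried by `K`. -/
def carriedBy (C : ℝ≥0) (K : Set Life) : Set IntMeasure :=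
  {ν | ν.toMeasure Set.univ ≤ C ∧ ν.toMeasure Kᶜ = 0}

/-- Finite measures of bounded mass on a compact set form a weakly compact set, and integrality is a
closed condition on it. -/
lemma isCompact_carriedBy (C : ℝ≥0) {K : Set Life} (hK : IsCompact K) :
    IsCompact (carriedBy C K) := by
  have h := (isCompact_setOfPred_finiteMeasure_le_of_isCompact C hK).inter_right
    (isClosed_setOf_natValued (X := Life))
  refine (IsEmbedding.subtypeVal.isCompact_iff (X := IntMeasure)).2 ?_
  convert! h using 1
  ext μ
  constructor
  · rintro ⟨ν, ⟨h1, h2⟩, rfl⟩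
    refine ⟨⟨?_, ?_⟩, ν.2⟩
    · rw [← ENNReal.coe_le_coe, FiniteMeasure.ennreal_mass]
      exact h1
    · rw [FiniteMeasure.null_iff_toMeasure_null]
      exact h2
  · rintro ⟨⟨h1, h2⟩, h3⟩
    refine ⟨⟨μ, h3⟩, ⟨?_, ?_⟩, rfl⟩
    · rw [← ENNReal.coe_le_coe, FiniteMeasure.ennreal_mass] at h1
      exact h1
    · rw [FiniteMeasure.null_iff_toMeasure_null] at h2
      exact h2

/-! ### Laplace functionals -/

/-- `ν ↦ exp(-⟨ν, f⟩)` as a bounded continuous function. -/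
noncomputable def laplaceFun (f : Life →ᵇ ℝ) (hf : ∀ x, 0 ≤ f x) : IntMeasure →ᵇ ℝ :=
  BoundedContinuousFunction.ofNormedAddCommGroup (fun ν => Real.exp (-ν.pair f))
    (Real.continuous_exp.comp (continuous_pair f).neg) 1 fun ν => by
      rw [Real.norm_eq_abs, Real.abs_exp, Real.exp_le_one_iff]
      exact neg_nonpos.2 (ν.pair_nonneg hf)

/-- The functions `ν ↦ exp(-⟨ν, f⟩)` form a multiplicative monoid. -/
noncomputable def laplaceMonoid : Submonoid (IntMeasure →ᵇ ℝ) where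
  carrier := {F | ∃ (f : Life →ᵇ ℝ) (hf : ∀ x, 0 ≤ f x), F = laplaceFun f hf}
  one_mem' := ⟨0, fun _ => le_rfl, by ext ν; simp [laplaceFun, pair]⟩
  mul_mem' := by
    rintro _ _ ⟨f, hf, rfl⟩ ⟨g, hg, rfl⟩
    refine ⟨f + g, fun x => add_nonneg (hf x) (hg x), ?_⟩
    ext ν
    have : ν.pair (f + g) = ν.pair f + ν.pair g :=
      integral_add (f.integrable ν.toMeasure) (g.integrable ν.toMeasure)
    simp only [laplaceFun, BoundedContinuousFunction.coe_mul, Pi.mul_apply,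
      BoundedContinuousFunction.coe_ofNormedAddCommGroup, BoundedContinuousFunction.coe_add]
    rw [this, ← Real.exp_add]
    ring_nf

lemma exists_pair_ne {ν μ : IntMeasure} (h : ν ≠ μ) :
    ∃ f : Life →ᵇ ℝ, (∀ x, 0 ≤ f x) ∧ ν.pair f ≠ μ.pair f := by
  by_contra! hc
  refine h (Subtype.ext (Subtype.ext ?_))
  change ν.toMeasure = μ.toMeasure
  refine ext_of_forall_lintegral_eq_of_IsFiniteMeasure fun f => ?_
  let f' : Life →ᵇ ℝ := ⟨⟨fun x => (f x : ℝ), by fun_prop⟩, f.map_bounded'⟩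
  have key : ∀ ρ : IntMeasure, ∫⁻ x, f x ∂ρ.toMeasure = ENNReal.ofReal (ρ.pair f') := by
    intro ρ
    rw [pair, ofReal_integral_eq_lintegral_ofReal (f'.integrable ρ.toMeasure)
      (Eventually.of_forall fun x => (f x).coe_nonneg)]
    exact lintegral_congr fun x => (ENNReal.ofReal_coe_nnreal (p := f x)).symm
  have h' := hc f' fun x => (f x).coe_nonneg
  exact (key ν).trans ((congrArg ENNReal.ofReal h').trans (key μ).symm)

/-- The input for Stone–Weierstrass: distinct measures differ on some nonnegative bounded continuous
`f`, and `exp` is injective. -/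
lemma laplace_separatesPoints :
    ((Algebra.adjoin ℝ (laplaceMonoid : Set (IntMeasure →ᵇ ℝ))).map
      (toContinuousMapₐ ℝ)).SeparatesPoints := by
  intro ν μ hne
  obtain ⟨f, hf, h⟩ := exists_pair_ne hne
  refine ⟨_, ⟨toContinuousMapₐ ℝ (laplaceFun f hf),
    ⟨laplaceFun f hf, Algebra.subset_adjoin ⟨f, hf, rfl⟩, rfl⟩, rfl⟩, ?_⟩
  intro he
  have he : Real.exp (-ν.pair f) = Real.exp (-μ.pair f) := he
  exact h (neg_injective (Real.exp_injective he))

end IntMeasure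

/-! ### Convergence from convergence on a separating algebra -/

section

variable {E : Type*} [TopologicalSpace E] [MeasurableSpace E] [BorelSpace E]

/-- Two probability measures that are tight along the same compact sets and agree on an algebra of
bounded continuous functions that separates points have the same integrals of bounded continuous
functions. -/
theorem integral_eq_of_separatesPoints_of_tight {P Q : Measure E} [IsProbabilityMeasure P]
    [IsProbabilityMeasure Q] {A : Subalgebra ℝ (E →ᵇ ℝ)}
    (hA : (A.map (toContinuousMapₐ ℝ)).SeparatesPoints)
    (heq : ∀ g ∈ A, ∫ x, g x ∂P = ∫ x, g x ∂Q)
    (htight : ∀ ε : ℝ, 0 < ε → ∃ K, IsCompact K ∧ MeasurableSet K ∧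
      P Kᶜ < ENNReal.ofReal ε ∧ Q Kᶜ < ENNReal.ofReal ε) (f : E →ᵇ ℝ) :
    ∫ x, f x ∂P = ∫ x, f x ∂Q := by
  -- `f` is damped to `f exp(-ε f²)`, which is at most `ε^(-1/2)` in absolute value, so a set of
  -- measure below `ε` costs `√ε`. For each measure the errors are `√ε` off `K` for `f`, the same
  -- for `g`, and `√ε` on `K` from Stone–Weierstrass: `3√ε`, hence `6√ε` for the two measures. The
  -- damped `g` has equal integrals because `g` lies in the algebra `A`.
  have hbound : ∀ ε : ℝ, 0 < ε →
      |∫ x, Real.mulExpNegMulSq ε (f x) ∂P - ∫ x, Real.mulExpNegMulSq ε (f x) ∂Q| ≤ 6 * √ε := by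
    intro ε hε
    obtain ⟨K, hK, hKm, hP, hQ⟩ := htight ε hε
    obtain ⟨g', hg'A, hg'approx⟩ :=
      ContinuousMap.exists_mem_subalgebra_near_continuous_of_isCompact_of_separatesPoints
        hA f hK (Real.sqrt_pos.2 hε)
    obtain ⟨g, hgA, rfl⟩ := Subalgebra.mem_map.1 hg'A
    have happ : ∀ x ∈ K, |g x - f x| < √ε := hg'approx
    have hmid : ∀ μ : Measure E, IsProbabilityMeasure μ → μ Kᶜ < ENNReal.ofReal ε →
        |∫ x, Real.mulExpNegMulSq ε (g x) ∂μ - ∫ x, Real.mulExpNegMulSq ε (f x) ∂μ| ≤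
          3 * √ε := by
      intro μ _ hμ
      have h1 := abs_lt.1 (abs_integral_sub_setIntegral_mulExpNegMulSq_comp_lt
        (g : C(E, ℝ)) hKm hε hμ)
      have h2 := abs_lt.1 (abs_integral_sub_setIntegral_mulExpNegMulSq_comp_lt
        (f : C(E, ℝ)) hKm hε hμ)
      have h3 := abs_setIntegral_mulExpNegMulSq_comp_sub_le_mul_measure (P := μ) hK hKm
        (f : C(E, ℝ)) (g : C(E, ℝ)) hε happ
      have h4 : √ε * (μ K).toReal ≤ √ε :=
        mul_le_of_le_one_right (Real.sqrt_nonneg _) measureReal_le_one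
      have h5 := abs_le.1 (h3.trans h4)
      simp only [ContinuousMap.coe_coe] at h1 h2 h5
      exact abs_le.2 ⟨by linarith, by linarith⟩
    have h1 := abs_le.1 (hmid P inferInstance hP)
    have h2 := abs_le.1 (hmid Q inferInstance hQ)
    have h3 := integral_mulExpNegMulSq_comp_eq hε heq hgA
    exact abs_le.2 ⟨by linarith, by linarith⟩
  have h0 : Tendsto (fun ε : ℝ => 6 * √ε) (𝓝[>] 0) (𝓝 0) := by
    have h : Tendsto (fun ε : ℝ => 6 * √ε) (𝓝 0) (𝓝 (6 * √0)) :=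
      (Real.continuous_sqrt.tendsto 0).const_mul 6
    rw [Real.sqrt_zero, mul_zero] at h
    exact h.mono_left nhdsWithin_le_nhds
  have lim1 := squeeze_zero' (Eventually.of_forall fun _ => abs_nonneg _)
    (eventually_nhdsWithin_of_forall hbound) h0
  have lim2 := ((tendsto_integral_mulExpNegMulSq_comp (P := P) f).sub
    (tendsto_integral_mulExpNegMulSq_comp (P := Q) f)).abs
  exact sub_eq_zero.1 (abs_eq_zero.1 (tendsto_nhds_unique lim2 lim1))

end

/-! ### Tight families of laws and their Laplace functionals -/

section

variable {K : ℕ → Set IntMeasure} {v w : ℕ → ℝ≥0}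

lemma integral_eq_of_laplace_eq {P Q : ProbabilityMeasure IntMeasure}
    (hK : ∀ n, IsCompact (K n)) (hv : Tendsto v atTop (𝓝 0)) (hw : Tendsto w atTop (𝓝 0))
    (hP : ∀ n, P (K n)ᶜ ≤ v n) (hQ : ∀ n, Q (K n)ᶜ ≤ w n)
    (h : ∀ f : Life →ᵇ ℝ, (∀ x, 0 ≤ f x) →
      ∫ ν, Real.exp (-ν.pair f) ∂(P : Measure IntMeasure) =
        ∫ ν, Real.exp (-ν.pair f) ∂(Q : Measure IntMeasure)) (F : IntMeasure →ᵇ ℝ) :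
    ∫ ν, F ν ∂(P : Measure IntMeasure) = ∫ ν, F ν ∂(Q : Measure IntMeasure) := by
  refine integral_eq_of_separatesPoints_of_tight IntMeasure.laplace_separatesPoints
    (fun g hg => ?_) (fun ε hε => ?_) F
  -- The Laplace functions are closed under products, so the algebra they generate is only their
  -- linear span, and linearity of the integral suffices.
  · have hg' : g ∈ Submodule.span ℝ (IntMeasure.laplaceMonoid : Set (IntMeasure →ᵇ ℝ)) := by
      have := Algebra.adjoin_eq_span ℝ (IntMeasure.laplaceMonoid : Set (IntMeasure →ᵇ ℝ))
      rw [Submonoid.closure_eq] at this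
      rw [← this]
      exact hg
    clear hg
    induction hg' using Submodule.span_induction with
    | mem g hg =>
      obtain ⟨f, hf, rfl⟩ := hg
      exact h f hf
    | zero => simp
    | add a b _ _ iha ihb =>
      simp only [BoundedContinuousFunction.coe_add, Pi.add_apply]
      rw [integral_add (a.integrable _) (b.integrable _),
        integral_add (a.integrable _) (b.integrable _), iha, ihb]
    | smul c a _ iha =>
      simp only [BoundedContinuousFunction.coe_smul]
      rw [integral_smul, integral_smul, iha]
  · have h1 : ∀ u : ℕ → ℝ≥0, Tendsto u atTop (𝓝 0) → ∀ᶠ n in atTop, (u n : ℝ) < ε := fun u hu =>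
      ((NNReal.continuous_coe.tendsto _).comp hu).eventually_lt_const (by simpa using hε)
    obtain ⟨n, hn1, hn2⟩ := ((h1 v hv).and (h1 w hw)).exists
    have hle : ∀ (R : ProbabilityMeasure IntMeasure) (c : ℝ≥0), R (K n)ᶜ ≤ c → (c : ℝ) < ε →
        (R : Measure IntMeasure) (K n)ᶜ < ENNReal.ofReal ε := by
      intro R c hR hc
      rw [← ProbabilityMeasure.ennreal_coeFn_eq_coeFn_toMeasure]
      refine (ENNReal.coe_le_coe.2 hR).trans_lt ?_
      rwa [← ENNReal.ofReal_coe_nnreal, ENNReal.ofReal_lt_ofReal_iff hε]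
    exact ⟨K n, hK n, (hK n).isClosed.measurableSet, hle P _ (hP n) hn1, hle Q _ (hQ n) hn2⟩

variable {ι : Type*} {l : Filter ι} {μ : ι → ProbabilityMeasure IntMeasure}

lemma tendsto_integral_laplace {η : ProbabilityMeasure IntMeasure} (h : Tendsto μ l (𝓝 η))
    (f : Life →ᵇ ℝ) (hf : ∀ x, 0 ≤ f x) :
    Tendsto (fun i => ∫ ν, Real.exp (-ν.pair f) ∂(μ i : Measure IntMeasure)) l
      (𝓝 (∫ ν, Real.exp (-ν.pair f) ∂(η : Measure IntMeasure))) :=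
  ProbabilityMeasure.tendsto_iff_forall_integral_tendsto.1 h (IntMeasure.laplaceFun f hf)

/-- A tight family whose Laplace functionals converge has a tight limit point. -/
lemma exists_laplace_eq_of_tendsto [l.NeBot] (hK : ∀ n, IsCompact (K n)) (hKm : Monotone K)
    (hv : Tendsto v atTop (𝓝 0)) (hμ : ∀ᶠ i in l, ∀ n, μ i (K n)ᶜ ≤ v n)
    {Φ : (Life →ᵇ ℝ) → ℝ} (hΦ : ∀ f : Life →ᵇ ℝ, (∀ x, 0 ≤ f x) →
      Tendsto (fun i => ∫ ν, Real.exp (-ν.pair f) ∂(μ i : Measure IntMeasure)) l (𝓝 (Φ f))) :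
    ∃ η : ProbabilityMeasure IntMeasure, (∀ n, η (K n)ᶜ ≤ v n) ∧
      ∀ f : Life →ᵇ ℝ, (∀ x, 0 ≤ f x) →
        ∫ ν, Real.exp (-ν.pair f) ∂(η : Measure IntMeasure) = Φ f := by
  have hc := isCompact_setOfPred_probabilityMeasure_mass_eq_compl_isCompact_le hv hK (.inr hKm)
  -- An ultrafilter finer than `l` converges in the compact set of laws with tails bounded by `v`,
  -- so the limit inherits these tail bounds.
  obtain ⟨η, hη, hlim⟩ := hc.ultrafilter_le_nhds ((Ultrafilter.of l).map μ)
    (le_principal_iff.2 (Ultrafilter.of_le l hμ))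
  refine ⟨η, hη, fun f hf => ?_⟩
  exact tendsto_nhds_unique (tendsto_integral_laplace (l := (Ultrafilter.of l : Filter ι)) hlim f hf)
    ((hΦ f hf).mono_left (Ultrafilter.of_le l))

/-- Convergence of the Laplace functionals of a tight family implies weak convergence. -/
theorem tendsto_of_tendsto_laplace (hK : ∀ n, IsCompact (K n)) (hKm : Monotone K)
    (hv : Tendsto v atTop (𝓝 0)) (hw : Tendsto w atTop (𝓝 0))
    (hμ : ∀ᶠ i in l, ∀ n, μ i (K n)ᶜ ≤ v n) {η : ProbabilityMeasure IntMeasure}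
    (hη : ∀ n, η (K n)ᶜ ≤ w n) (h : ∀ f : Life →ᵇ ℝ, (∀ x, 0 ≤ f x) →
      Tendsto (fun i => ∫ ν, Real.exp (-ν.pair f) ∂(μ i : Measure IntMeasure)) l
        (𝓝 (∫ ν, Real.exp (-ν.pair f) ∂(η : Measure IntMeasure)))) :
    Tendsto μ l (𝓝 η) := by
  have hc := isCompact_setOfPred_probabilityMeasure_mass_eq_compl_isCompact_le hv hK (.inr hKm)
  refine (tendsto_iff_ultrafilter _ _ _).2 fun U hU => ?_
  obtain ⟨η', hη', hlim⟩ := hc.ultrafilter_le_nhds (U.map μ) (le_principal_iff.2 (hU hμ))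
  have hlim : Tendsto μ U (𝓝 η') := hlim
  -- The limit `η'` along `U` need not be shown equal to `η`: weak convergence sees only integrals
  -- of bounded continuous functions, and these agree.
  refine ProbabilityMeasure.tendsto_iff_forall_integral_tendsto.2 fun F => ?_
  rw [← integral_eq_of_laplace_eq hK hv hw hη' hη (fun f hf => ?_) F]
  · exact ProbabilityMeasure.tendsto_iff_forall_integral_tendsto.1 hlim F
  · exact tendsto_nhds_unique (tendsto_integral_laplace hlim f hf) ((h f hf).mono_left hU)

end

/-! ### A renewal inequality -/

/-- Translation turns the left side into the integral of `φ` over `(-∞, T - s)`. -/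
lemma setLIntegral_Iio_comp_sub_le {φ : ℝ → ℝ≥0∞} (T : ℝ) {s : ℝ} (hs : 0 ≤ s) :
    ∫⁻ t in Set.Iio T, φ (t - s) ≤ ∫⁻ t in Set.Iio T, φ t := by
  rw [← lintegral_indicator measurableSet_Iio, ← lintegral_indicator measurableSet_Iio]
  rw [← lintegral_sub_right_eq_self (fun t => (Set.Iio T).indicator (fun t => φ t) t) s]
  refine lintegral_mono fun t => ?_
  by_cases ht : t < T
  · rw [Set.indicator_of_mem (Set.mem_Iio.2 ht),
      Set.indicator_of_mem (Set.mem_Iio.2 (by linarith : t - s < T))]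
  · rw [Set.indicator_of_notMem (show t ∉ Set.Iio T from ht)]
    exact zero_le

/-- A bounded solution of a renewal inequality with a defective kernel `b` is integrable. -/
theorem lintegral_le_of_renewal_ineq {φ H b : ℝ → ℝ≥0∞} (hφ : Measurable φ) (hb : Measurable b)
    (hφ1 : ∀ t, φ t ≤ 1) (hφ0 : ∀ t < 0, φ t = 0) {ρ : ℝ≥0∞}
    (hρ : ∫⁻ s in Set.Ioi (0 : ℝ), b s = ρ) (hρ1 : ρ < 1) (hH : Measurable H)
    (h : ∀ t, 0 ≤ t → φ t ≤ H t + ∫⁻ s in Set.Ioi (0 : ℝ), b s * φ (t - s)) :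
    ∫⁻ t, φ t ≤ (1 - ρ)⁻¹ * ∫⁻ t in Set.Ici (0 : ℝ), H t := by
  -- Integrating the inequality up to `T` gives `I ≤ ∫ H + ρ I`. The truncation makes `I` finite,
  -- since `φ ≤ 1` vanishes before `0`, so `ρ I` can be absorbed; then `T → ∞`.
  have hI : ∀ T : ℝ, ∫⁻ t in Set.Iio T, φ t ≤ (1 - ρ)⁻¹ * ∫⁻ t in Set.Ici (0 : ℝ), H t := by
    intro T
    set I := ∫⁻ t in Set.Iio T, φ t with hIdef
    have hfin : I ≠ ⊤ := by
      have h1 : I ≤ ∫⁻ t, (Set.Ico 0 T).indicator 1 t := by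
        rw [hIdef, ← lintegral_indicator measurableSet_Iio]
        refine lintegral_mono fun t => ?_
        by_cases ht : t < T
        · rw [Set.indicator_of_mem (Set.mem_Iio.2 ht)]
          rcases lt_or_ge t 0 with h0 | h0
          · rw [hφ0 t h0]; exact zero_le
          · rw [Set.indicator_of_mem (Set.mem_Ico.2 ⟨h0, ht⟩)]; exact hφ1 t
        · rw [Set.indicator_of_notMem (show t ∉ Set.Iio T from ht)]; exact zero_le
      rw [lintegral_indicator_one measurableSet_Ico] at h1
      exact (h1.trans_lt (by simp)).ne
    have h1 : I ≤ (∫⁻ t in Set.Ici (0 : ℝ), H t) +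
        ∫⁻ t in Set.Iio T, ∫⁻ s in Set.Ioi (0 : ℝ), b s * φ (t - s) := by
      rw [hIdef, ← lintegral_indicator measurableSet_Iio, ← lintegral_indicator measurableSet_Iio,
        ← lintegral_indicator measurableSet_Ici,
        ← lintegral_add_left (hH.indicator measurableSet_Ici)]
      refine lintegral_mono fun t => ?_
      by_cases ht : t < T
      · simp only [Set.indicator_of_mem (Set.mem_Iio.2 ht)]
        rcases lt_or_ge t 0 with h0 | h0
        · rw [hφ0 t h0]; exact zero_le
        · rw [Set.indicator_of_mem (Set.mem_Ici.2 h0)]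
          exact h t h0
      · rw [Set.indicator_of_notMem (show t ∉ Set.Iio T from ht)]; exact zero_le
    have h2 : ∫⁻ t in Set.Iio T, ∫⁻ s in Set.Ioi (0 : ℝ), b s * φ (t - s) ≤ ρ * I := by
      rw [lintegral_lintegral_swap]
      · rw [← hρ, ← lintegral_mul_const _ hb]
        refine setLIntegral_mono (hb.mul_const _) fun s hs => ?_
        rw [lintegral_const_mul (f := fun t => φ (t - s)) _ (hφ.comp (by fun_prop))]
        gcongr
        exact setLIntegral_Iio_comp_sub_le T (le_of_lt hs)
      · exact ((hb.comp measurable_snd).mul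
          (hφ.comp (measurable_fst.sub measurable_snd))).aemeasurable
    have h3 : (1 - ρ) * I ≤ ∫⁻ t in Set.Ici (0 : ℝ), H t := by
      rw [ENNReal.sub_mul (fun _ _ => hfin), one_mul, tsub_le_iff_right]
      exact h1.trans (add_le_add_right h2 _)
    exact (ENNReal.mul_le_iff_le_inv (tsub_pos_of_lt hρ1).ne' (by finiteness)).1 h3
  have hU : (⋃ n : ℕ, Set.Iio (n : ℝ)) = Set.univ :=
    Set.eq_univ_of_forall fun x => Set.mem_iUnion.2 (exists_nat_gt x)
  rw [← setLIntegral_univ, ← hU, setLIntegral_iUnion_of_directed]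
  · exact iSup_le fun n => hI n
  · exact (monotone_nat_of_le_succ fun n => Set.Iio_subset_Iio (by simp)).directed_le

/-! ### Elementary facts on the rates -/

/-- `∫_0^∞ k(x - t) dt`. -/
noncomputable def travel (k : ℝ → ℝ≥0∞) (x : ℝ) : ℝ≥0∞ := ∫⁻ t in Set.Ioi (0 : ℝ), k (x - t)

lemma measurable_travel {k : ℝ → ℝ≥0∞} (hk : Measurable k) : Measurable (travel k) :=
  Measurable.lintegral_prod_right' (f := fun p : ℝ × ℝ => k (p.1 - p.2)) (by fun_prop)

lemma travel_le {k : ℝ → ℝ≥0∞} {K : ℝ≥0∞} (hk0 : ∀ y ≤ 0, k y = 0) (hK : ∀ y, k y ≤ K) (x : ℝ) :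
    travel k x ≤ K * ENNReal.ofReal x := by
  have h : travel k x ≤ ∫⁻ t, (Set.Ioo 0 x).indicator (fun _ => K) t := by
    rw [travel, ← lintegral_indicator measurableSet_Ioi]
    refine lintegral_mono fun t => ?_
    by_cases h0 : t ∈ Set.Ioi (0 : ℝ)
    · rw [Set.indicator_of_mem h0]
      rcases lt_or_ge t x with hx | hx
      · rw [Set.indicator_of_mem (Set.mem_Ioo.2 ⟨h0, hx⟩)]; exact hK _
      · rw [hk0 _ (by linarith)]; exact zero_le
    · rw [Set.indicator_of_notMem h0]; exact zero_le
  rw [lintegral_indicator_const measurableSet_Ioo, Real.volume_Ioo, sub_zero] at h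
  exact h

lemma zext_of_nonpos (h : Life → ℝ) {y : ℝ} (hy : y ≤ 0) : zext h y = 0 := by
  simp [zext, not_lt.2 hy]

lemma zext_of_pos (h : Life → ℝ) {y : ℝ} (hy : 0 < y) : zext h y = h ⟨y, hy⟩ := by
  simp [zext, hy]

/-- `|f - h|`, extended by zero. -/
noncomputable def absDiff (f h : BPos) (y : ℝ) : ℝ≥0∞ :=
  ENNReal.ofReal |zext f.toFun y - zext h.toFun y|

lemma measurable_absDiff (f h : BPos) : Measurable (absDiff f h) :=
  ((BranchingParams.measurable_zext f.measurable).sub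
    (BranchingParams.measurable_zext h.measurable)).abs.ennreal_ofReal

lemma absDiff_of_nonpos (f h : BPos) {y : ℝ} (hy : y ≤ 0) : absDiff f h y = 0 := by
  simp [absDiff, zext_of_nonpos _ hy]

lemma absDiff_le {f h : BPos} {K : ℝ} (hf : ∀ x, f.toFun x ≤ K) (hh : ∀ x, h.toFun x ≤ K) (y : ℝ) :
    absDiff f h y ≤ ENNReal.ofReal K := by
  rcases le_or_gt y 0 with hy | hy
  · rw [absDiff_of_nonpos f h hy]; exact zero_le
  · refine ENNReal.ofReal_le_ofReal ?_
    rw [zext_of_pos _ hy, zext_of_pos _ hy]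
    exact abs_sub_le_iff.2 ⟨by linarith [hf ⟨y, hy⟩, h.nonneg ⟨y, hy⟩],
      by linarith [hh ⟨y, hy⟩, f.nonneg ⟨y, hy⟩]⟩

lemma abs_exp_neg_sub_le {a b : ℝ} (ha : 0 ≤ a) (hb : 0 ≤ b) :
    |Real.exp (-a) - Real.exp (-b)| ≤ |a - b| := by
  wlog hab : a ≤ b generalizing a b
  · rw [abs_sub_comm, abs_sub_comm a]
    exact this hb ha (le_of_not_ge hab)
  rw [abs_of_nonneg (sub_nonneg.2 (Real.exp_le_exp.2 (neg_le_neg hab))),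
    abs_sub_comm, abs_of_nonneg (sub_nonneg.2 hab)]
  have h1 : Real.exp (-b) = Real.exp (-a) * Real.exp (-(b - a)) := by
    rw [← Real.exp_add]; ring_nf
  have h2 := Real.add_one_le_exp (-(b - a))
  have h3 : Real.exp (-a) ≤ 1 := Real.exp_le_one_iff.2 (neg_nonpos.2 ha)
  have h4 := Real.exp_pos (-a)
  rw [h1]
  nlinarith

namespace BranchingParams

variable (D : BranchingParams)

lemma measurable_mean : Measurable D.mean := by
  refine Measurable.ennreal_toReal (Measurable.tsum fun i => Measurable.mul_const ?_ _)
  have h := (IsC1BddPos_measurable (D.p_c1 i)).ennreal_ofReal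
  simpa [ENNReal.ofReal_toReal ((D.p _).apply_ne_top i)] using h

lemma mean_eq_tsum (x : Life) : D.mean x = ∑' i : ℕ, (D.p x i).toReal * i := by
  rw [mean, ENNReal.tsum_toReal_eq
    (fun i => ENNReal.mul_ne_top ((D.p x).apply_ne_top i) (ENNReal.natCast_ne_top i))]
  simp

/-- Unlike in `g_lip`, the constant is the mean at the point `x` itself. A uniform bound would give
a renewal kernel larger than `birthDensity`, possibly of mass at least `1`. -/
lemma g_sub_le (x : Life) {a b : ℝ} (ha : a ∈ Set.Icc (0 : ℝ) 1) (hb : b ∈ Set.Icc (0 : ℝ) 1)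
    (hab : a ≤ b) : D.g x b - D.g x a ≤ D.mean x * (b - a) := by
  obtain ⟨m, -, hm⟩ := D.exists_mean_bound
  unfold g
  rw [← (D.g_summable x hb).tsum_sub (D.g_summable x ha), mean_eq_tsum, ← tsum_mul_right]
  refine Summable.tsum_le_tsum (fun i => ?_)
    ((D.g_summable x hb).sub (D.g_summable x ha)) ((hm x).1.mul_right _)
  rw [← mul_sub, mul_assoc]
  exact mul_le_mul_of_nonneg_left (pow_sub_pow_le ha hb hab i) ENNReal.toReal_nonneg

/-- `α(y) g'(y, 1-)`, extended by zero. -/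
noncomputable def meanRate (y : ℝ) : ℝ≥0∞ := ENNReal.ofReal (zext D.α y * zext D.mean y)

lemma measurable_meanRate : Measurable D.meanRate :=
  ((measurable_zext (IsC1BddPos_measurable D.α_c1)).mul
    (measurable_zext D.measurable_mean)).ennreal_ofReal

lemma meanRate_of_nonpos {y : ℝ} (hy : y ≤ 0) : D.meanRate y = 0 := by
  simp [meanRate, zext_of_nonpos _ hy]

lemma exists_meanRate_le : ∃ C : ℝ≥0, ∀ y, D.meanRate y ≤ C := by
  obtain ⟨A, hA⟩ := D.α_c1.bdd
  obtain ⟨m, hm0, hm⟩ := D.exists_mean_bound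
  refine ⟨(A * m).toNNReal, fun y => ?_⟩
  rcases le_or_gt y 0 with hy | hy
  · rw [D.meanRate_of_nonpos hy]; exact zero_le
  · refine ENNReal.ofReal_le_ofReal ?_
    rw [zext_of_pos _ hy, zext_of_pos _ hy, mean_eq_tsum]
    refine mul_le_mul (hA _) (hm _).2 ?_ ((D.α_c1.nonneg _).trans (hA ⟨y, hy⟩))
    exact tsum_nonneg fun i => mul_nonneg ENNReal.toReal_nonneg (Nat.cast_nonneg i)

lemma ofReal_abs_rate_sub_le (y : ℝ) {a b : ℝ} (ha : a ∈ Set.Icc (0 : ℝ) 1)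
    (hb : b ∈ Set.Icc (0 : ℝ) 1) :
    ENNReal.ofReal |D.rate y a - D.rate y b| ≤ D.meanRate y * ENNReal.ofReal |a - b| := by
  wlog hab : a ≤ b generalizing a b
  · rw [abs_sub_comm, abs_sub_comm a]
    exact this hb ha (le_of_not_ge hab)
  rcases le_or_gt y 0 with hy | hy
  · rw [D.rate_of_not_pos (not_lt.2 hy), D.rate_of_not_pos (not_lt.2 hy)]
    simp
  · have h1 : 0 ≤ D.α ⟨y, hy⟩ := D.α_c1.nonneg _
    have h2 : 0 ≤ D.mean ⟨y, hy⟩ := ENNReal.toReal_nonneg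
    rw [meanRate, zext_of_pos _ hy, zext_of_pos _ hy, ← ENNReal.ofReal_mul (mul_nonneg h1 h2)]
    refine ENNReal.ofReal_le_ofReal ?_
    rw [abs_of_nonneg (sub_nonneg.2 (D.rate_anti y ha hb hab)), abs_sub_comm,
      abs_of_nonneg (sub_nonneg.2 hab), D.rate_of_pos hy, D.rate_of_pos hy, ← mul_sub, mul_assoc]
    refine mul_le_mul_of_nonneg_left ?_ h1
    linarith [D.g_sub_le ⟨y, hy⟩ ha hb hab]

/-- The extension by zero makes the restriction to `s < x` automatic; in this form the integrand is
jointly measurable in `(s, x)`. -/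
lemma birthDensity_eq (s : ℝ) : D.birthDensity s = ∫⁻ x : Life, D.meanRate (x - s) ∂D.G := by
  have hs : MeasurableSet {x : Life | s < x} :=
    measurableSet_lt measurable_const measurable_subtype_coe
  rw [birthDensity, ← lintegral_indicator hs]
  refine lintegral_congr fun x => ?_
  by_cases hx : s < x
  · rw [Set.indicator_of_mem (by exact hx)]; rfl
  · rw [Set.indicator_of_notMem (show x ∉ {x : Life | s < x} from hx),
      D.meanRate_of_nonpos (by linarith)]

lemma measurable_birthDensity : Measurable D.birthDensity := by
  have h : D.birthDensity = fun s => ∫⁻ x : Life, D.meanRate (x - s) ∂D.G :=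
    funext D.birthDensity_eq
  rw [h]
  exact Measurable.lintegral_prod_right' (f := fun p : ℝ × Life => D.meanRate (p.2 - p.1))
    (D.measurable_meanRate.comp (by fun_prop))

/-! ### Stability of the cumulants -/

section

variable (f h : BPos)

/-- `|⟨G, exp(-u_t f)⟩ - ⟨G, exp(-u_t h)⟩|`, extended by zero to negative times. -/
noncomputable def gap (t : ℝ) : ℝ≥0∞ :=
  (Set.Ici (0 : ℝ)).indicator (fun t => ENNReal.ofReal
    |D.expG (D.cumulant f) t.toNNReal - D.expG (D.cumulant h) t.toNNReal|) t

lemma measurable_gap : Measurable (D.gap f h) :=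
  Measurable.indicator (((D.measurable_expG (D.cumulant_spec f).measurable).comp
    measurable_real_toNNReal).sub ((D.measurable_expG (D.cumulant_spec h).measurable).comp
    measurable_real_toNNReal)).abs.ennreal_ofReal measurableSet_Ici

lemma gap_of_neg {t : ℝ} (ht : t < 0) : D.gap f h t = 0 :=
  Set.indicator_of_notMem (by simpa using ht) _

lemma gap_of_nonneg {t : ℝ} (ht : 0 ≤ t) : D.gap f h t = ENNReal.ofReal
    |D.expG (D.cumulant f) t.toNNReal - D.expG (D.cumulant h) t.toNNReal| :=
  Set.indicator_of_mem (Set.mem_Ici.2 ht) _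

lemma gap_le_one (t : ℝ) : D.gap f h t ≤ 1 := by
  rcases lt_or_ge t 0 with ht | ht
  · rw [D.gap_of_neg f h ht]; exact zero_le
  · rw [D.gap_of_nonneg f h ht, ENNReal.ofReal_le_one]
    have a := D.expG_mem (D.cumulant_spec f).measurable (D.cumulant_spec f).nonneg t.toNNReal
    have b := D.expG_mem (D.cumulant_spec h).measurable (D.cumulant_spec h).nonneg t.toNNReal
    exact abs_sub_le_iff.2 ⟨by linarith [a.2, b.1], by linarith [b.2, a.1]⟩

/-- `|u_t f - u_t h|`. -/
noncomputable def cumulantDist (t : ℝ≥0) (x : Life) : ℝ≥0∞ :=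
  ENNReal.ofReal |D.cumulant f t x - D.cumulant h t x|

lemma measurable_cumulantDist : Measurable (Function.uncurry (D.cumulantDist f h)) :=
  ((D.cumulant_spec f).measurable.sub (D.cumulant_spec h).measurable).abs.ennreal_ofReal

/-- Subtract the two cumulant equations and use the Lipschitz bound for `rate`. The integral over
`(0, t]` may run over `(0, ∞)`, which gives a convolution. -/
lemma cumulantDist_le (t : ℝ≥0) (x : Life) :
    D.cumulantDist f h t x ≤ absDiff f h (x - t) +
      ∫⁻ s in Set.Ioi (0 : ℝ), D.meanRate (x - s) * D.gap f h (t - s) := by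
  have hf := D.cumulant_spec f
  have hh := D.cumulant_spec h
  have hqf := D.expG_mem hf.measurable hf.nonneg
  have hqh := D.expG_mem hh.measurable hh.nonneg
  have hif := D.intervalIntegrable_rate (D.measurable_expG hf.measurable) hqf t x
  have hih := D.intervalIntegrable_rate (D.measurable_expG hh.measurable) hqh t x
  have e : D.cumulant f t x - D.cumulant h t x =
      (zext f.toFun (x - t) - zext h.toFun (x - t)) + ∫ s in (0 : ℝ)..t,
        (D.rate (x - s) (D.expG (D.cumulant f) (t - s).toNNReal) -
          D.rate (x - s) (D.expG (D.cumulant h) (t - s).toNNReal)) := by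
    rw [intervalIntegral.integral_sub hif hih, hf.eq_rhs, hh.eq_rhs]
    simp only [rhs]; ring
  rw [cumulantDist, e]
  refine (ENNReal.ofReal_le_ofReal (abs_add_le _ _)).trans ?_
  rw [ENNReal.ofReal_add (abs_nonneg _) (abs_nonneg _)]
  refine add_le_add_right ?_ _
  rw [intervalIntegral.integral_of_le t.coe_nonneg, ← Real.norm_eq_abs, ofReal_norm]
  refine (enorm_integral_le_lintegral_enorm _).trans ?_
  rw [← lintegral_indicator measurableSet_Ioc, ← lintegral_indicator measurableSet_Ioi]
  refine lintegral_mono fun s => ?_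
  by_cases hs : s ∈ Set.Ioc (0 : ℝ) t
  · rw [Set.indicator_of_mem hs, Set.indicator_of_mem (Set.mem_Ioi.2 hs.1),
      D.gap_of_nonneg f h (sub_nonneg.2 hs.2), Real.enorm_eq_ofReal_abs]
    exact D.ofReal_abs_rate_sub_le _ (hqf _) (hqh _)
  · rw [Set.indicator_of_notMem hs]; exact zero_le

/-- Since `exp(-·)` is 1-Lipschitz on `[0, ∞)`, `gap` is at most the `G`-mean of `cumulantDist`.
Fubini then turns the convolution kernel `meanRate (x - s)` into `birthDensity s`. -/
lemma gap_le {t : ℝ} (ht : 0 ≤ t) :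
    D.gap f h t ≤ ∫⁻ x : Life, absDiff f h (x - t) ∂D.G +
      ∫⁻ s in Set.Ioi (0 : ℝ), D.birthDensity s * D.gap f h (t - s) := by
  have hf := D.cumulant_spec f
  have hh := D.cumulant_spec h
  have h1 : D.gap f h t ≤ ∫⁻ x, D.cumulantDist f h t.toNNReal x ∂D.G := by
    rw [D.gap_of_nonneg f h ht, expG, expG,
      ← integral_sub (D.integrable_exp hf.measurable hf.nonneg _)
        (D.integrable_exp hh.measurable hh.nonneg _), ← Real.norm_eq_abs, ofReal_norm]
    refine (enorm_integral_le_lintegral_enorm _).trans (lintegral_mono fun x => ?_)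
    rw [Real.enorm_eq_ofReal_abs]
    exact ENNReal.ofReal_le_ofReal (abs_exp_neg_sub_le (hf.nonneg _ _) (hh.nonneg _ _))
  have hm : Measurable fun p : Life × ℝ => D.meanRate (p.1 - p.2) * D.gap f h (t - p.2) :=
    (D.measurable_meanRate.comp (by fun_prop)).mul ((D.measurable_gap f h).comp (by fun_prop))
  refine h1.trans ((lintegral_mono fun x => D.cumulantDist_le f h t.toNNReal x).trans ?_)
  rw [Real.coe_toNNReal t ht, lintegral_add_left (f := fun x : Life => absDiff f h (x - t))
    ((measurable_absDiff f h).comp (by fun_prop))]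
  refine add_le_add_right (le_of_eq ?_) _
  rw [lintegral_lintegral_swap hm.aemeasurable]
  refine lintegral_congr fun s => ?_
  rw [lintegral_mul_const (f := fun x : Life => D.meanRate (x - s)) _
    (D.measurable_meanRate.comp (by fun_prop)), birthDensity_eq]

lemma lintegral_gap_le {ρ : ℝ≥0∞} (hρ : ∫⁻ s in Set.Ioi (0 : ℝ), D.birthDensity s = ρ)
    (hρ1 : ρ < 1) :
    ∫⁻ t, D.gap f h t ≤ (1 - ρ)⁻¹ * ∫⁻ x : Life, travel (absDiff f h) x ∂D.G := by
  have hm : Measurable fun p : ℝ × Life => absDiff f h (p.2 - p.1) :=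
    (measurable_absDiff f h).comp (by fun_prop)
  refine (lintegral_le_of_renewal_ineq (D.measurable_gap f h) D.measurable_birthDensity
    (D.gap_le_one f h) (fun t ht => D.gap_of_neg f h ht) hρ hρ1 hm.lintegral_prod_right'
    fun t ht => D.gap_le f h ht).trans_eq ?_
  rw [setLIntegral_congr Ioi_ae_eq_Ici.symm, lintegral_lintegral_swap hm.aemeasurable]
  rfl

/-- The time integral of a convolution factors, and `∫ meanRate (x - s) ds ≤ C x`. This linear
growth in `x` is why first moments are what matters later. -/
lemma lintegral_cumulantDist_le {C : ℝ≥0} (hC : ∀ y, D.meanRate y ≤ C) (x : Life) :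
    ∫⁻ t in Set.Ioi (0 : ℝ), D.cumulantDist f h t.toNNReal x ≤
      travel (absDiff f h) x + C * ENNReal.ofReal x * ∫⁻ t, D.gap f h t := by
  have hm : Measurable fun p : ℝ × ℝ => D.meanRate (x - p.2) * D.gap f h (p.1 - p.2) :=
    (D.measurable_meanRate.comp (by fun_prop)).mul ((D.measurable_gap f h).comp (by fun_prop))
  have h1 : ∫⁻ t in Set.Ioi (0 : ℝ), D.cumulantDist f h t.toNNReal x ≤
      ∫⁻ t in Set.Ioi (0 : ℝ), (absDiff f h (x - t) +
        ∫⁻ s in Set.Ioi (0 : ℝ), D.meanRate (x - s) * D.gap f h (t - s)) := by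
    refine setLIntegral_mono (Measurable.add ((measurable_absDiff f h).comp (by fun_prop))
      hm.lintegral_prod_right') fun t ht => ?_
    have := D.cumulantDist_le f h t.toNNReal x
    rwa [Real.coe_toNNReal t (le_of_lt ht)] at this
  refine h1.trans ?_
  rw [lintegral_add_left (f := fun t : ℝ => absDiff f h (x - t))
    ((measurable_absDiff f h).comp (by fun_prop))]
  refine add_le_add_right ?_ _
  refine (setLIntegral_le_lintegral _ _).trans ?_
  rw [lintegral_lintegral_swap hm.aemeasurable]
  have h2 : ∀ s : ℝ, ∫⁻ t, D.meanRate (x - s) * D.gap f h (t - s) =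
      D.meanRate (x - s) * ∫⁻ t, D.gap f h t := by
    intro s
    rw [lintegral_const_mul (f := fun t : ℝ => D.gap f h (t - s)) _
      ((D.measurable_gap f h).comp (by fun_prop)),
      lintegral_sub_right_eq_self]
  simp only [h2]
  rw [lintegral_mul_const (f := fun s : ℝ => D.meanRate (x - s)) _
    (D.measurable_meanRate.comp (by fun_prop))]
  gcongr
  exact travel_le (fun y hy => D.meanRate_of_nonpos hy) hC x

/-- An individual of remaining lifetime `x` gives birth only at times `s < x`, so it meets `gap`
only at times `t - s > t - x`. -/
lemma cumulantDist_le_tail {C : ℝ≥0} (hC : ∀ y, D.meanRate y ≤ C) (t : ℝ≥0) (x : Life) :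
    D.cumulantDist f h t x ≤ absDiff f h (x - t) +
      C * ∫⁻ r in Set.Ioi ((t : ℝ) - x), D.gap f h r := by
  refine (D.cumulantDist_le f h t x).trans (add_le_add_right ?_ _)
  rw [← lintegral_const_mul _ (D.measurable_gap f h), ← lintegral_indicator measurableSet_Ioi,
    ← lintegral_indicator measurableSet_Ioi,
    ← lintegral_sub_left_eq_self ((Set.Ioi ((t : ℝ) - x)).indicator _) (t : ℝ)]
  refine lintegral_mono fun s => ?_
  by_cases hs : s ∈ Set.Ioi (0 : ℝ)
  · rw [Set.indicator_of_mem hs]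
    rcases lt_or_ge s x with hx | hx
    · rw [Set.indicator_of_mem (Set.mem_Ioi.2 (by linarith))]
      gcongr
      exact hC _
    · rw [D.meanRate_of_nonpos (by linarith), zero_mul]; exact zero_le
  · rw [Set.indicator_of_notMem hs]; exact zero_le

end

end BranchingParams

/-! ### Comparison with the zero function -/

instance : Zero BPos := ⟨⟨fun _ => 0, measurable_const, fun _ => le_rfl, 0, fun _ => le_rfl⟩⟩

lemma zext_zero (y : ℝ) : zext (0 : BPos).toFun y = 0 := by
  unfold zext; split_ifs <;> rfl

namespace BranchingParams

variable (D : BranchingParams)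

lemma rate_one (y : ℝ) : D.rate y 1 = 0 := by
  by_cases hy : y ∈ Set.Ioi (0 : ℝ)
  · rw [D.rate_of_pos hy]
    simp [g, (D.p_hasSum _).tsum_eq]
  · exact D.rate_of_not_pos hy 1

/-- Zero solves the equation because `g(x, 1) = 1`. With `h = 0` the stability estimates become
bounds on `u_t f` itself. -/
lemma cumulant_zero : D.cumulant 0 = fun _ _ => 0 := by
  refine D.isCumulant_unique (D.cumulant_spec 0) ⟨measurable_const, fun _ _ => le_rfl, fun t x => ?_⟩
  rw [zext_zero, zero_add]
  have h : ∀ s : ℝ, zext D.α (x - s) * (1 - zext (fun y => D.g y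
      (∫ z, Real.exp (-(fun (_ : ℝ≥0) (_ : Life) => (0 : ℝ)) (t - s).toNNReal z) ∂D.G)) (x - s)) =
      D.rate (x - s) 1 := by
    intro s
    simp [rate]
  simp only [h, rate_one]
  simp

lemma cumulantDist_zero (f : BPos) (t : ℝ≥0) (x : Life) :
    D.cumulantDist f 0 t x = ENNReal.ofReal (D.cumulant f t x) := by
  rw [cumulantDist, cumulant_zero, sub_zero, abs_of_nonneg ((D.cumulant_spec f).nonneg t x)]

lemma measurable_cumulant (f : BPos) (t : ℝ≥0) : Measurable (D.cumulant f t) :=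
  (D.cumulant_spec f).measurable.comp measurable_prodMk_left

lemma exists_abs_cumulant_le (f : BPos) (t : ℝ≥0) : ∃ K : ℝ, ∀ x, |D.cumulant f t x| ≤ K := by
  have h := D.cumulant_spec f
  obtain ⟨K, hK⟩ := D.exists_rhs_bound f t
  refine ⟨K, fun x => ?_⟩
  rw [abs_of_nonneg (h.nonneg t x), h.eq_rhs]
  exact hK t le_rfl x _ (D.measurable_expG h.measurable) (D.expG_mem h.measurable h.nonneg)

end BranchingParams

/-! ### The lifetime law has a finite mean -/

/-- Since `x` is at most the number of integers `n ≥ 0` with `n < x`, the mean of `G` is at most `∑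
(1 - G(n))`, which the upper Riemann sum with mesh `1` dominates. -/
lemma SubcriticalCramer.lintegral_G_lt_top {D : BranchingParams} {α₁ : ℝ}
    (h : SubcriticalCramer D α₁) : ∫⁻ x : Life, ENNReal.ofReal x ∂D.G < ⊤ := by
  refine lt_of_le_of_lt ?_ (h.dri.upper_lt_top 1 one_pos)
  have hm : ∀ n : ℕ, MeasurableSet {x : Life | (n : ℝ) < x} := fun n =>
    measurableSet_lt measurable_const measurable_subtype_coe
  have h1 : ∀ x : Life, ENNReal.ofReal x ≤
      ∑' n : ℕ, {x : Life | (n : ℝ) < x}.indicator (1 : Life → ℝ≥0∞) x := by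
    intro x
    have hs : ∑ n ∈ Finset.range ⌈(x : ℝ)⌉₊, {x : Life | (n : ℝ) < x}.indicator
        (1 : Life → ℝ≥0∞) x = (⌈(x : ℝ)⌉₊ : ℝ≥0∞) := by
      rw [Finset.sum_congr rfl (g := fun _ => (1 : ℝ≥0∞))]
      · simp
      · intro n hn
        exact Set.indicator_of_mem (s := {x : Life | (n : ℝ) < x})
          (Nat.lt_ceil.1 (Finset.mem_range.1 hn)) _
    refine le_trans ?_ (hs.symm.le.trans (ENNReal.sum_le_tsum _))
    exact ENNReal.ofReal_le_of_le_toReal (by simpa using Nat.le_ceil (x : ℝ))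
  refine (lintegral_mono h1).trans ?_
  rw [lintegral_tsum fun n => (measurable_one.indicator (hm n)).aemeasurable]
  refine ENNReal.tsum_le_tsum fun n => ?_
  rw [lintegral_indicator_one (hm n), ENNReal.ofReal_one, one_mul]
  -- The supremum over the cell `[n, n + 1]` is bounded below by the value at its left endpoint,
  -- where the exponential factor is at least `1`.
  refine le_trans ?_ (le_iSup₂_of_le (n : ℝ) (by simp) le_rfl)
  have hc : {x : Life | (n : ℝ) < x} = {x : Life | (x : ℝ) ≤ n}ᶜ := by
    ext x; simp
  have hc' : MeasurableSet {x : Life | (x : ℝ) ≤ n} :=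
    measurableSet_le measurable_subtype_coe measurable_const
  rw [← ofReal_measureReal, hc, probReal_compl_eq_one_sub hc']
  refine ENNReal.ofReal_le_ofReal (le_mul_of_one_le_left (sub_nonneg.2 measureReal_le_one) ?_)
  exact Real.one_le_exp (mul_nonneg h.pos.le (Nat.cast_nonneg n))

/-! ### The immigration functional -/

section Immigration

variable (L : Measure NonzeroIntMeasure)

/-- The intensity measure `∫ ν L(dν)` of the immigrants. -/
noncomputable def intensity : Measure Life := L.bind fun ν => ν.1.toMeasure

instance [SFinite L] : SFinite (intensity L) :=
  inferInstanceAs (SFinite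
    ((IntMeasure.kernel.comap (Subtype.val : NonzeroIntMeasure → IntMeasure) (by fun_prop)) ∘ₘ L))

lemma lintegral_intensity {k : Life → ℝ≥0∞} (hk : Measurable k) :
    ∫⁻ x, k x ∂intensity L = ∫⁻ ν, ∫⁻ x, k x ∂ν.1.toMeasure ∂L :=
  Measure.lintegral_bind (IntMeasure.measurable_toMeasure.comp measurable_subtype_coe).aemeasurable
    hk.aemeasurable

variable {L} in
lemma lintegral_intensity_lt_top {α₁ : ℝ} (hα₁ : 0 < α₁)
    (hL : ∫⁻ ν, ∫⁻ x, ENNReal.ofReal (Real.exp (α₁ * (x : ℝ))) ∂ν.1.toMeasure ∂L < ⊤) :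
    ∫⁻ x : Life, ENNReal.ofReal x ∂intensity L < ⊤ := by
  rw [← lintegral_intensity L (by fun_prop)] at hL
  -- From `α₁ x + 1 ≤ exp(α₁ x)`: the exponential moment dominates the first moment.
  have h : ∀ x : Life, ENNReal.ofReal x ≤
      ENNReal.ofReal α₁⁻¹ * ENNReal.ofReal (Real.exp (α₁ * (x : ℝ))) := by
    intro x
    rw [← ENNReal.ofReal_mul (inv_nonneg.2 hα₁.le)]
    refine ENNReal.ofReal_le_ofReal ?_
    rw [le_inv_mul_iff₀ hα₁]
    linarith [Real.add_one_le_exp (α₁ * (x : ℝ))]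
  refine (lintegral_mono h).trans_lt ?_
  rw [lintegral_const_mul _ (by fun_prop)]
  exact ENNReal.mul_lt_top ENNReal.ofReal_lt_top hL

lemma measurable_pair_immigrant {f : Life → ℝ} (hf : Measurable f) {K : ℝ} (hK : ∀ x, |f x| ≤ K) :
    Measurable fun ν : NonzeroIntMeasure => ν.1.pair f :=
  (IntMeasure.measurable_pair hf hK).comp measurable_subtype_coe

lemma psi_zero : psi L (fun _ => 0) = 0 := by simp [psi, IntMeasure.pair]

variable [IsFiniteMeasure L]

/-- `r ↦ 1 - exp(-r)` is 1-Lipschitz on `[0, ∞)`, so the difference is at most the `L`-integral of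
`⟨ν, |f - h|⟩`. -/
lemma ofReal_abs_psi_sub_le {f h : Life → ℝ} (hf : Measurable f) (hh : Measurable h)
    (hf0 : ∀ x, 0 ≤ f x) (hh0 : ∀ x, 0 ≤ h x) {K K' : ℝ} (hfK : ∀ x, |f x| ≤ K)
    (hhK : ∀ x, |h x| ≤ K') :
    ENNReal.ofReal |psi L f - psi L h| ≤ ∫⁻ x, ENNReal.ofReal |f x - h x| ∂intensity L := by
  have hi : ∀ {f : Life → ℝ} {K : ℝ}, Measurable f → (∀ x, 0 ≤ f x) → (∀ x, |f x| ≤ K) →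
      Integrable (fun ν : NonzeroIntMeasure => 1 - Real.exp (-ν.1.pair f)) L := by
    intro f K hf hf0 hK
    refine (integrable_const 1).sub (Integrable.of_bound (C := 1) (Real.measurable_exp.comp
      (measurable_pair_immigrant hf hK).neg).aestronglyMeasurable (Eventually.of_forall fun ν => ?_))
    rw [Real.norm_eq_abs, Real.abs_exp, Real.exp_le_one_iff]
    exact neg_nonpos.2 (ν.1.pair_nonneg hf0)
  rw [psi, psi, ← integral_sub (hi hf hf0 hfK) (hi hh hh0 hhK), ← Real.norm_eq_abs, ofReal_norm,
    lintegral_intensity L (by fun_prop)]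
  refine (enorm_integral_le_lintegral_enorm _).trans (lintegral_mono fun ν => ?_)
  rw [Real.enorm_eq_ofReal_abs]
  have h1 : |1 - Real.exp (-ν.1.pair f) - (1 - Real.exp (-ν.1.pair h))| ≤
      |ν.1.pair f - ν.1.pair h| := by
    rw [sub_sub_sub_cancel_left, abs_sub_comm]
    exact abs_exp_neg_sub_le (ν.1.pair_nonneg hf0) (ν.1.pair_nonneg hh0)
  refine (ENNReal.ofReal_le_ofReal h1).trans ?_
  rw [IntMeasure.pair, IntMeasure.pair, ← integral_sub (ν.1.integrable_of_bound hf hfK)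
    (ν.1.integrable_of_bound hh hhK), ← Real.norm_eq_abs, ofReal_norm]
  refine (enorm_integral_le_lintegral_enorm _).trans_eq ?_
  simp only [Real.enorm_eq_ofReal_abs]

variable (D : BranchingParams)

lemma measurable_psi_cumulant (f : BPos) :
    Measurable fun s : ℝ => psi L (D.cumulant f s.toNNReal) := by
  let κ : Kernel (ℝ × NonzeroIntMeasure) Life :=
    IntMeasure.kernel.comap (fun p => p.2.1) (by fun_prop)
  have h1 : StronglyMeasurable fun q : (ℝ × NonzeroIntMeasure) × Life =>
      D.cumulant f q.1.1.toNNReal q.2 :=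
    ((D.cumulant_spec f).measurable.comp (g := Function.uncurry (D.cumulant f))
      (f := fun q : (ℝ × NonzeroIntMeasure) × Life => (q.1.1.toNNReal, q.2))
      (by fun_prop)).stronglyMeasurable
  have h2 : StronglyMeasurable fun p : ℝ × NonzeroIntMeasure =>
      p.2.1.pair (D.cumulant f p.1.toNNReal) := h1.integral_kernel_prod_right' (κ := κ)
  have h3 : StronglyMeasurable fun p : ℝ × NonzeroIntMeasure =>
      1 - Real.exp (-p.2.1.pair (D.cumulant f p.1.toNNReal)) :=
    (measurable_const.sub (Real.measurable_exp.comp h2.measurable.neg)).stronglyMeasurable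
  exact h3.integral_prod_right'.measurable

lemma lintegral_psi_sub_le (f h : BPos) {C : ℝ≥0} (hC : ∀ y, D.meanRate y ≤ C) :
    ∫⁻ s in Set.Ioi (0 : ℝ), ENNReal.ofReal
        |psi L (D.cumulant f s.toNNReal) - psi L (D.cumulant h s.toNNReal)| ≤
      ∫⁻ x : Life, travel (absDiff f h) x ∂intensity L +
        C * (∫⁻ t, D.gap f h t) * ∫⁻ x : Life, ENNReal.ofReal x ∂intensity L := by
  have h1 : ∀ s : ℝ, ENNReal.ofReal
      |psi L (D.cumulant f s.toNNReal) - psi L (D.cumulant h s.toNNReal)| ≤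
        ∫⁻ x, D.cumulantDist f h s.toNNReal x ∂intensity L := by
    intro s
    obtain ⟨K, hK⟩ := D.exists_abs_cumulant_le f s.toNNReal
    obtain ⟨K', hK'⟩ := D.exists_abs_cumulant_le h s.toNNReal
    exact ofReal_abs_psi_sub_le L (D.measurable_cumulant f _) (D.measurable_cumulant h _)
      ((D.cumulant_spec f).nonneg _) ((D.cumulant_spec h).nonneg _) hK hK'
  have hm : Measurable fun p : ℝ × Life => D.cumulantDist f h p.1.toNNReal p.2 :=
    (D.measurable_cumulantDist f h).comp (g := Function.uncurry (D.cumulantDist f h))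
      (f := fun p : ℝ × Life => (p.1.toNNReal, p.2)) (by fun_prop)
  refine (lintegral_mono h1).trans ?_
  rw [lintegral_lintegral_swap hm.aemeasurable]
  refine (lintegral_mono fun x => D.lintegral_cumulantDist_le f h hC x).trans_eq ?_
  rw [lintegral_add_left (f := fun x : Life => travel (absDiff f h) x)
    ((measurable_travel (measurable_absDiff f h)).comp measurable_subtype_coe),
    ← lintegral_const_mul _ (by fun_prop)]
  congr 1
  exact lintegral_congr fun x => by ring

/-- The differences of the cumulants and of their immigration functionals are controlled by the
time that the lives spend in the region where the data differ. Of the Cramér condition only the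
finite means of the lifetimes and of the immigration are used. -/
theorem exists_measure_control {D : BranchingParams} {α₁ : ℝ} (hα₁ : SubcriticalCramer D α₁)
    (hL : ∫⁻ ν, ∫⁻ x, ENNReal.ofReal (Real.exp (α₁ * (x : ℝ))) ∂ν.1.toMeasure ∂L < ⊤)
    {C : ℝ≥0} (hC : ∀ y, D.meanRate y ≤ C) :
    ∃ N : Measure Life, ∫⁻ x : Life, ENNReal.ofReal x ∂N < ⊤ ∧ ∀ f h : BPos,
      C * ∫⁻ t, D.gap f h t ≤ ∫⁻ x : Life, travel (absDiff f h) x ∂N ∧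
      ∫⁻ s in Set.Ioi (0 : ℝ), ENNReal.ofReal
        |psi L (D.cumulant f s.toNNReal) - psi L (D.cumulant h s.toNNReal)| ≤
          ∫⁻ x : Life, travel (absDiff f h) x ∂N := by
  set m := ∫⁻ x : Life, ENNReal.ofReal x ∂intensity L with hm
  have hmfin : m < ⊤ := lintegral_intensity_lt_top hα₁.pos hL
  set ρ := ∫⁻ s in Set.Ioi (0 : ℝ), D.birthDensity s with hρ
  -- `C (1 - ρ)⁻¹` comes from the bound on `∫ gap`; in the factor `1 + m`, the `1` serves the
  -- estimate for `gap` and the `m` that for `ψ`.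
  set c : ℝ≥0∞ := C * (1 - ρ)⁻¹ * (1 + m) with hc
  have hcfin : c ≠ ⊤ := ENNReal.mul_ne_top (ENNReal.mul_ne_top ENNReal.coe_ne_top
    (ENNReal.inv_ne_top.2 (tsub_pos_of_lt hα₁.subcritical).ne')) (by finiteness)
  refine ⟨intensity L + c • D.G, ?_, fun f h => ?_⟩
  · rw [lintegral_add_measure, lintegral_smul_measure]
    exact ENNReal.add_lt_top.2 ⟨hmfin, ENNReal.mul_lt_top hcfin.lt_top hα₁.lintegral_G_lt_top⟩
  have hgap := D.lintegral_gap_le f h hρ.symm hα₁.subcritical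
  rw [lintegral_add_measure, lintegral_smul_measure, smul_eq_mul]
  set a := ∫⁻ x : Life, travel (absDiff f h) x ∂D.G
  set Δ := ∫⁻ t, D.gap f h t
  have h1 : C * Δ * (1 + m) ≤ c * a := by
    calc C * Δ * (1 + m) ≤ C * ((1 - ρ)⁻¹ * a) * (1 + m) := by gcongr
      _ = c * a := by rw [hc]; ring
  constructor
  · calc C * Δ = C * Δ * 1 := (mul_one _).symm
      _ ≤ C * Δ * (1 + m) := by gcongr; exact le_self_add
      _ ≤ _ := h1.trans le_add_self
  · refine (lintegral_psi_sub_le L D f h hC).trans (add_le_add_right ?_ _)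
    exact le_trans (by gcongr; exact le_add_self) h1

end Immigration

/-! ### Continuity of the bounds -/

/-- Dominated convergence twice: in time with majorant `K` on `(0, x)`, then in `x` with majorant `K
x`. -/
lemma tendsto_lintegral_travel {N : Measure Life} (hN : ∫⁻ x : Life, ENNReal.ofReal x ∂N < ⊤)
    {F : ℕ → BPos} {f : BPos} {K : ℝ} (hF : ∀ n x, (F n).toFun x ≤ K) (hf : ∀ x, f.toFun x ≤ K)
    (h : ∀ x, Tendsto (fun n => (F n).toFun x) atTop (𝓝 (f.toFun x))) :
    Tendsto (fun n => ∫⁻ x : Life, travel (absDiff (F n) f) x ∂N) atTop (𝓝 0) := by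
  have hk : ∀ y, Tendsto (fun n => absDiff (F n) f y) atTop (𝓝 0) := by
    intro y
    rcases le_or_gt y 0 with hy | hy
    · simp [absDiff_of_nonpos _ _ hy]
    · simp only [absDiff, zext_of_pos _ hy]
      have := ENNReal.tendsto_ofReal ((h ⟨y, hy⟩).sub_const (f.toFun ⟨y, hy⟩)).abs
      simpa using this
  have ht : ∀ x, Tendsto (fun n => travel (absDiff (F n) f) x) atTop (𝓝 0) := by
    intro x
    rw [← lintegral_zero (μ := volume.restrict (Set.Ioi (0 : ℝ)))]
    refine tendsto_lintegral_of_dominated_convergence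
      ((Set.Iio x).indicator fun _ => ENNReal.ofReal K)
      (fun n => (measurable_absDiff _ _).comp (by fun_prop))
      (fun n => Eventually.of_forall fun t => ?_) ?_ (Eventually.of_forall fun t => hk _)
    · by_cases hx : t ∈ Set.Iio x
      · rw [Set.indicator_of_mem hx]; exact absDiff_le (hF n) hf _
      · rw [Set.indicator_of_notMem hx]
        exact (absDiff_of_nonpos _ _ (sub_nonpos.2 (not_lt.1 hx))).le
    · rw [lintegral_indicator_const measurableSet_Iio, Measure.restrict_apply measurableSet_Iio,
        Set.Iio_inter_Ioi, Real.volume_Ioo]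
      finiteness
  rw [← lintegral_zero (μ := N)]
  refine tendsto_lintegral_of_dominated_convergence
    (fun x : Life => ENNReal.ofReal K * ENNReal.ofReal x)
    (fun n => (measurable_travel (measurable_absDiff _ _)).comp measurable_subtype_coe)
    (fun n => Eventually.of_forall fun x =>
      travel_le (fun y hy => absDiff_of_nonpos _ _ hy) (absDiff_le (hF n) hf) x) ?_
    (Eventually.of_forall fun x => ht x)
  rw [lintegral_const_mul _ (by fun_prop)]
  exact ENNReal.mul_ne_top ENNReal.ofReal_ne_top hN.ne

lemma lintegral_travel_ne_top {N : Measure Life} (hN : ∫⁻ x : Life, ENNReal.ofReal x ∂N < ⊤)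
    (f h : BPos) : ∫⁻ x : Life, travel (absDiff f h) x ∂N ≠ ⊤ := by
  obtain ⟨K, hK⟩ := f.bdd
  obtain ⟨K', hK'⟩ := h.bdd
  refine ne_top_of_le_ne_top ?_ (lintegral_mono fun x : Life => travel_le
    (fun y hy => absDiff_of_nonpos _ _ hy) (absDiff_le (K := max K K')
      (fun x => (hK x).trans (le_max_left _ _)) fun x => (hK' x).trans (le_max_right _ _)) (x : ℝ))
  rw [lintegral_const_mul _ (by fun_prop)]
  exact ENNReal.mul_ne_top ENNReal.ofReal_ne_top hN.ne

/-! ### The descendants of the initial population die out -/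

/-- The masses of `(n, ∞)` are integers decreasing to `0`, so they vanish eventually. Thus every
member of the initial population is dead after a fixed time. -/
lemma IntMeasure.exists_measure_Ioi_eq_zero (σ : IntMeasure) :
    ∃ T : ℝ≥0, σ.toMeasure {x : Life | (T : ℝ) < x} = 0 := by
  have hm : ∀ n : ℕ, MeasurableSet {x : Life | (n : ℝ) < x} := fun n =>
    measurableSet_lt measurable_const measurable_subtype_coe
  have hlim : Tendsto (fun n : ℕ => σ.toMeasure {x : Life | (n : ℝ) < x}) atTop (𝓝 0) := by
    have h := tendsto_measure_iInter_atTop (μ := σ.toMeasure) (s := fun n : ℕ => {x : Life | (n : ℝ) < x})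
      (fun n => (hm n).nullMeasurableSet) (fun m n hmn x hx => by
        have : (m : ℝ) ≤ n := by exact_mod_cast hmn
        exact this.trans_lt hx) ⟨0, measure_ne_top _ _⟩
    have he : ⋂ n : ℕ, {x : Life | (n : ℝ) < x} = ∅ := by
      refine Set.eq_empty_of_forall_notMem fun x hx => ?_
      obtain ⟨n, hn⟩ := exists_nat_gt (x : ℝ)
      exact lt_asymm hn (Set.mem_iInter.1 hx n)
    rwa [he, measure_empty] at h
  obtain ⟨n, hn⟩ := (hlim.eventually_lt_const one_pos).exists
  refine ⟨n, ?_⟩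
  obtain ⟨k, hk⟩ := σ.exists_measure_eq (hm n)
  rw [hk] at hn
  have : k = 0 := by
    have : k < 1 := by exact_mod_cast hn
    omega
  rw [NNReal.coe_natCast, hk, this, Nat.cast_zero]

lemma ofReal_pair_cumulant_le {D : BranchingParams} {C : ℝ≥0} (hC : ∀ y, D.meanRate y ≤ C)
    (f : BPos) {σ : IntMeasure} {T t : ℝ≥0} (hσ : σ.toMeasure {x : Life | (T : ℝ) < x} = 0)
    (ht : T ≤ t) :
    ENNReal.ofReal (σ.pair (D.cumulant f t)) ≤
      C * (∫⁻ r in Set.Ioi ((t : ℝ) - T), D.gap f 0 r) * σ.toMeasure Set.univ := by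
  obtain ⟨K, hK⟩ := D.exists_abs_cumulant_le f t
  rw [IntMeasure.pair, ofReal_integral_eq_lintegral_ofReal
    (σ.integrable_of_bound (D.measurable_cumulant f t) hK)
    (Eventually.of_forall ((D.cumulant_spec f).nonneg t)), ← lintegral_const (μ := σ.toMeasure)]
  have hae : ∀ᵐ x : Life ∂σ.toMeasure, (x : ℝ) ≤ T := by
    rw [ae_iff]
    simpa using hσ
  refine lintegral_mono_ae (hae.mono fun x hx => ?_)
  have hxt : (x : ℝ) ≤ t := hx.trans (by exact_mod_cast ht)
  rw [← D.cumulantDist_zero]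
  refine (D.cumulantDist_le_tail f 0 hC t x).trans ?_
  rw [absDiff_of_nonpos _ _ (sub_nonpos.2 hxt), zero_add]
  gcongr

/-- Once the initial individuals are dead, what remains is at most the total mass of `σ` times the
tail of an integrable function. -/
lemma tendsto_pair_cumulant {D : BranchingParams} {C : ℝ≥0} (hC : ∀ y, D.meanRate y ≤ C)
    (f : BPos) (hgap : C * ∫⁻ t, D.gap f 0 t ≠ ⊤) (σ : IntMeasure) :
    Tendsto (fun t => σ.pair (D.cumulant f t)) atTop (𝓝 0) := by
  obtain ⟨T, hT⟩ := σ.exists_measure_Ioi_eq_zero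
  -- `C` stays under the integral: only the product `C * ∫ gap` is assumed finite, and `C` may be
  -- `0`.
  have h1 : Tendsto (fun t : ℝ≥0 => ∫⁻ r in Set.Ioi ((t : ℝ) - T), C * D.gap f 0 r) atTop
      (𝓝 0) := by
    rw [← lintegral_zero (μ := (volume : Measure ℝ))]
    simp_rw [← lintegral_indicator measurableSet_Ioi]
    refine tendsto_lintegral_filter_of_dominated_convergence (fun r => C * D.gap f 0 r)
      (Eventually.of_forall fun t =>
        ((D.measurable_gap f 0).const_mul _).indicator measurableSet_Ioi)
      (Eventually.of_forall fun t => Eventually.of_forall fun r => Set.indicator_le_self _ _ _) ?_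
      (Eventually.of_forall fun r => ?_)
    · rwa [lintegral_const_mul _ (D.measurable_gap f 0)]
    · refine tendsto_const_nhds.congr' ?_
      filter_upwards [eventually_ge_atTop (r + T).toNNReal] with t ht
      rw [Set.indicator_of_notMem]
      have := Real.toNNReal_le_iff_le_coe.1 ht
      simp only [Set.mem_Ioi, not_lt]
      linarith
  have h2 := ENNReal.Tendsto.mul_const h1 (.inr (measure_ne_top σ.toMeasure Set.univ))
  rw [zero_mul] at h2
  have h3 : Tendsto (fun t => ENNReal.ofReal (σ.pair (D.cumulant f t))) atTop (𝓝 0) := by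
    refine tendsto_of_tendsto_of_tendsto_of_le_of_le' tendsto_const_nhds h2
      (Eventually.of_forall fun _ => zero_le) ?_
    filter_upwards [eventually_ge_atTop T] with t ht
    rw [lintegral_const_mul _ (D.measurable_gap f 0)]
    exact ofReal_pair_cumulant_le hC f hT ht
  have h4 := (ENNReal.tendsto_toReal ENNReal.zero_ne_top).comp h3
  rw [ENNReal.toReal_zero] at h4
  refine h4.congr fun t => ?_
  exact ENNReal.toReal_ofReal (σ.pair_nonneg ((D.cumulant_spec f).nonneg t))

/-! ### The limiting Laplace exponent -/

section Exponent

variable {D : BranchingParams} {L : Measure NonzeroIntMeasure} [IsFiniteMeasure L]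

lemma integrableOn_psi_cumulant {f : BPos} {B : ℝ≥0∞} (hB : B ≠ ⊤)
    (h : ∫⁻ s in Set.Ioi (0 : ℝ), ENNReal.ofReal
      |psi L (D.cumulant f s.toNNReal) - psi L (D.cumulant 0 s.toNNReal)| ≤ B) :
    IntegrableOn (fun s : ℝ => psi L (D.cumulant f s.toNNReal)) (Set.Ioi 0) := by
  refine ⟨(measurable_psi_cumulant L D f).aestronglyMeasurable, ?_⟩
  refine lt_of_le_of_lt (le_trans (le_of_eq ?_) h) hB.lt_top
  simp only [D.cumulant_zero, psi_zero, sub_zero, Real.enorm_eq_ofReal_abs]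

lemma tendsto_integral_psi {N : Measure Life} (hN : ∫⁻ x : Life, ENNReal.ofReal x ∂N < ⊤)
    (hctrl : ∀ f h : BPos, ∫⁻ s in Set.Ioi (0 : ℝ), ENNReal.ofReal
      |psi L (D.cumulant f s.toNNReal) - psi L (D.cumulant h s.toNNReal)| ≤
        ∫⁻ x : Life, travel (absDiff f h) x ∂N)
    {F : ℕ → BPos} {f : BPos} {K : ℝ} (hF : ∀ n x, (F n).toFun x ≤ K) (hf : ∀ x, f.toFun x ≤ K)
    (h : ∀ x, Tendsto (fun n => (F n).toFun x) atTop (𝓝 (f.toFun x))) :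
    Tendsto (fun n => ∫ s in Set.Ioi (0 : ℝ), psi L (D.cumulant (F n) s.toNNReal)) atTop
      (𝓝 (∫ s in Set.Ioi (0 : ℝ), psi L (D.cumulant f s.toNNReal))) := by
  have hi : ∀ f : BPos, IntegrableOn (fun s : ℝ => psi L (D.cumulant f s.toNNReal)) (Set.Ioi 0) :=
    fun f => integrableOn_psi_cumulant (lintegral_travel_ne_top hN f 0) (hctrl f 0)
  refine tendsto_integral_of_L1 _ (hi f).1 (Eventually.of_forall fun n => hi (F n)) ?_
  refine tendsto_of_tendsto_of_tendsto_of_le_of_le tendsto_const_nhds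
    (tendsto_lintegral_travel hN hF hf h) (fun _ => zero_le) fun n => ?_
  simpa only [Real.enorm_eq_ofReal_abs] using hctrl (F n) f

/-- A Laplace functional that is known on continuous functions is known on all bounded Borel
functions. -/
theorem laplace_eq_of_continuous {N : Measure Life} (hN : ∫⁻ x : Life, ENNReal.ofReal x ∂N < ⊤)
    (hctrl : ∀ f h : BPos, ∫⁻ s in Set.Ioi (0 : ℝ), ENNReal.ofReal
      |psi L (D.cumulant f s.toNNReal) - psi L (D.cumulant h s.toNNReal)| ≤
        ∫⁻ x : Life, travel (absDiff f h) x ∂N)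
    {η : ProbabilityMeasure IntMeasure}
    (hη : ∀ f : BPos, Continuous f.toFun → ∫ ν, Real.exp (-ν.pair f.toFun) ∂(η : Measure IntMeasure) =
      Real.exp (-∫ s in Set.Ioi (0 : ℝ), psi L (D.cumulant f s.toNNReal))) (f : BPos) :
    ∫ ν, Real.exp (-ν.pair f.toFun) ∂(η : Measure IntMeasure) =
      Real.exp (-∫ s in Set.Ioi (0 : ℝ), psi L (D.cumulant f s.toNNReal)) := by
  -- The Baire class contains signed functions, while Laplace functionals need nonnegative ones. The
  -- induction is on the positive part, which preserves continuity and bounded pointwise limits.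
  suffices H : ∀ g : Life → ℝ, IsBddBaire g → ∀ b : BPos, (∀ x, b.toFun x = max (g x) 0) →
      ∫ ν, Real.exp (-ν.pair b.toFun) ∂(η : Measure IntMeasure) =
        Real.exp (-∫ s in Set.Ioi (0 : ℝ), psi L (D.cumulant b s.toNNReal)) by
    obtain ⟨K, hK⟩ := f.bdd
    refine H f.toFun (isBddBaire_of_measurable f.measurable (K := K) fun x => ?_) f fun x => ?_
    · rw [abs_of_nonneg (f.nonneg x)]; exact hK x
    · exact (max_eq_left (f.nonneg x)).symm
  intro g hg
  induction hg with
  | cont g =>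
    intro b hb
    refine hη b ?_
    rw [funext hb]
    fun_prop
  | lim F g K hF hK hg ih =>
    intro b hb
    have hFK : ∀ n x, max (F n x) 0 ≤ K := fun n x =>
      max_le ((le_abs_self _).trans (hK n x)) ((abs_nonneg _).trans (hK n x))
    let B : ℕ → BPos := fun n => ⟨fun x => max (F n x) 0,
      (IntMeasure.measurable_of_isBddBaire (hF n)).1.max measurable_const,
      fun x => le_max_right _ _, K, hFK n⟩
    have hBlim : ∀ x, Tendsto (fun n => (B n).toFun x) atTop (𝓝 (b.toFun x)) := by
      intro x
      rw [hb x]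
      exact (hg x).max tendsto_const_nhds
    have hbK : ∀ x, b.toFun x ≤ K := fun x => le_of_tendsto' (hBlim x) fun n => hFK n x
    have h1 : Tendsto (fun n => ∫ ν, Real.exp (-ν.pair (B n).toFun) ∂(η : Measure IntMeasure))
        atTop (𝓝 (∫ ν, Real.exp (-ν.pair b.toFun) ∂(η : Measure IntMeasure))) := by
      have habs : ∀ n x, |(B n).toFun x| ≤ K := fun n x => by
        rw [abs_of_nonneg ((B n).nonneg x)]; exact hFK n x
      refine tendsto_integral_of_dominated_convergence (fun _ => 1) (fun n => ?_)
        (integrable_const _) (fun n => Eventually.of_forall fun ν => ?_)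
        (Eventually.of_forall fun ν => ?_)
      · exact (Real.measurable_exp.comp
          (IntMeasure.measurable_pair (B n).measurable (habs n)).neg).aestronglyMeasurable
      · rw [Real.norm_eq_abs, Real.abs_exp, Real.exp_le_one_iff]
        exact neg_nonpos.2 (ν.pair_nonneg (B n).nonneg)
      · exact (Real.continuous_exp.tendsto _).comp
          (ν.tendsto_pair (fun n => (B n).measurable) habs hBlim).neg
    have h2 := (Real.continuous_exp.tendsto _).comp
      (tendsto_integral_psi hN hctrl (fun n x => hFK n x) hbK hBlim).neg
    refine tendsto_nhds_unique h1 (h2.congr fun n => ?_)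
    exact (ih n (B n) fun _ => rfl).symm

end Exponent

/-! ### Tightness -/

/-- Markov's inequality for `1 - exp(-⟨ν, f⟩)`, which is at least `1 - exp(-1) ≥ 1/2` on this event.
-/
lemma measure_one_le_pair_le (P : ProbabilityMeasure IntMeasure) (f : BPos) :
    (P : Measure IntMeasure) {ν | 1 ≤ ν.pair f.toFun} ≤
      2 * ENNReal.ofReal (1 - ∫ ν, Real.exp (-ν.pair f.toFun) ∂(P : Measure IntMeasure)) := by
  obtain ⟨K, hK⟩ := f.bdd
  have hm := IntMeasure.measurable_pair f.measurable (K := K) fun x => by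
    rw [abs_of_nonneg (f.nonneg x)]; exact hK x
  have hle : ∀ ν : IntMeasure, Real.exp (-ν.pair f.toFun) ≤ 1 := fun ν =>
    Real.exp_le_one_iff.2 (neg_nonpos.2 (ν.pair_nonneg f.nonneg))
  have hi : Integrable (fun ν : IntMeasure => Real.exp (-ν.pair f.toFun)) P :=
    Integrable.of_bound (C := 1) (Real.measurable_exp.comp hm.neg).aestronglyMeasurable
      (Eventually.of_forall fun ν => by rw [Real.norm_eq_abs, Real.abs_exp]; exact hle ν)
  have h1 : 1 - ∫ ν, Real.exp (-ν.pair f.toFun) ∂(P : Measure IntMeasure) =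
      ∫ ν, (1 - Real.exp (-ν.pair f.toFun)) ∂(P : Measure IntMeasure) := by
    rw [integral_sub (integrable_const _) hi]; simp
  have hi' : Integrable (fun ν : IntMeasure => 1 - Real.exp (-ν.pair f.toFun)) P :=
    (integrable_const _).sub hi
  rw [h1, ofReal_integral_eq_lintegral_ofReal hi'
    (Eventually.of_forall fun ν => sub_nonneg.2 (hle ν)), ← lintegral_const_mul' _ _ (by simp),
    ← lintegral_indicator_one (measurableSet_le measurable_const hm)]
  refine lintegral_mono fun ν => ?_
  by_cases hν : 1 ≤ ν.pair f.toFun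
  · rw [Set.indicator_of_mem (by exact hν), ← ENNReal.ofReal_ofNat 2,
      ← ENNReal.ofReal_mul zero_le_two, Pi.one_apply, ← ENNReal.ofReal_one]
    refine ENNReal.ofReal_le_ofReal ?_
    have h2 : Real.exp (-ν.pair f.toFun) ≤ Real.exp (-1) := Real.exp_le_exp.2 (neg_le_neg hν)
    have h3 : Real.exp (-1) ≤ 1 / 2 := by
      rw [Real.exp_neg, one_div]
      exact inv_anti₀ two_pos (by linarith [Real.add_one_le_exp (1 : ℝ)])
    linarith
  · rw [Set.indicator_of_notMem (s := {ν : IntMeasure | 1 ≤ ν.pair f.toFun}) hν]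
    exact zero_le

/-- The window `[1 / (j + 1), j + 1]` of lifetimes. -/
def window (j : ℕ) : Set Life := {x | ((j : ℝ) + 1)⁻¹ ≤ x ∧ (x : ℝ) ≤ j + 1}

lemma measurableSet_window (j : ℕ) : MeasurableSet (window j) :=
  (measurableSet_le measurable_const measurable_subtype_coe).inter
    (measurableSet_le measurable_subtype_coe measurable_const)

lemma isCompact_window (j : ℕ) : IsCompact (window j) := by
  rw [Subtype.isCompact_iff]
  convert! isCompact_Icc (a := ((j : ℝ) + 1)⁻¹) (b := (j : ℝ) + 1) using 1
  ext y
  constructor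
  · rintro ⟨x, hx, rfl⟩
    exact hx
  · intro hy
    exact ⟨⟨y, lt_of_lt_of_le (by positivity) hy.1⟩, hy, rfl⟩

lemma window_mono : Monotone window := by
  intro i j hij x hx
  have h : (i : ℝ) + 1 ≤ j + 1 := by exact_mod_cast Nat.succ_le_succ hij
  exact ⟨(inv_anti₀ (by positivity) h).trans hx.1, hx.2.trans h⟩

lemma eventually_mem_window (x : Life) : ∀ᶠ j in atTop, x ∈ window j := by
  obtain ⟨m, hm⟩ := exists_nat_gt (x : ℝ)
  obtain ⟨n, hn⟩ := exists_nat_gt (x : ℝ)⁻¹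
  have hx : 0 < (x : ℝ) := x.2
  filter_upwards [eventually_ge_atTop m, eventually_ge_atTop n] with j hj1 hj2
  have h1 : (m : ℝ) ≤ j := by exact_mod_cast hj1
  have h2 : (n : ℝ) ≤ j := by exact_mod_cast hj2
  exact ⟨inv_le_of_inv_le₀ hx (by linarith), by linarith⟩

/-- The constant function `1 / (j + 1)`. -/
noncomputable def smallConst (j : ℕ) : BPos :=
  ⟨fun _ => ((j : ℝ) + 1)⁻¹, measurable_const, fun _ => by positivity, _, fun _ => le_rfl⟩

/-- The indicator of the complement of `window j`. -/
noncomputable def outside (j : ℕ) : BPos :=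
  ⟨(window j)ᶜ.indicator fun _ => 1, measurable_const.indicator (measurableSet_window j).compl,
    fun _ => Set.indicator_nonneg (fun _ _ => zero_le_one) _, 1,
    fun _ => Set.indicator_le_self' (fun _ _ => zero_le_one) _⟩

/-- An exhausting sequence of compact sets of integer-valued measures. -/
def compacts (j : ℕ) : Set IntMeasure := IntMeasure.carriedBy (j + 1) (window j)

lemma isCompact_compacts (j : ℕ) : IsCompact (compacts j) :=
  IntMeasure.isCompact_carriedBy _ (isCompact_window j)

lemma compacts_mono : Monotone compacts := fun i j hij ν hν =>
  ⟨hν.1.trans (by exact_mod_cast Nat.succ_le_succ hij),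
    measure_mono_null (Set.compl_subset_compl.2 (window_mono hij)) hν.2⟩

/-- Integrality matters here: nonzero mass outside the window is at least `1`, and mass above `j +
1` paired with `1 / (j + 1)` exceeds `1`. One threshold serves both escapes from compactness. -/
lemma compl_compacts_subset (j : ℕ) : (compacts j)ᶜ ⊆
    {ν | 1 ≤ ν.pair (smallConst j).toFun} ∪ {ν | 1 ≤ ν.pair (outside j).toFun} := by
  intro ν hν
  by_cases h1 : ν.toMeasure Set.univ ≤ ((j + 1 : ℝ≥0) : ℝ≥0∞)
  · right
    have h2 : ν.toMeasure (window j)ᶜ ≠ 0 := fun h2 => hν ⟨h1, h2⟩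
    obtain ⟨n, hn⟩ := ν.exists_measure_eq (measurableSet_window j).compl
    change 1 ≤ ν.pair ((window j)ᶜ.indicator fun _ => 1)
    rw [ν.pair_indicator (measurableSet_window j).compl, measureReal_def, hn]
    rw [hn] at h2
    have : 1 ≤ n := Nat.one_le_iff_ne_zero.2 (by exact_mod_cast h2)
    simpa using this
  · left
    have h2 : (j : ℝ) + 1 < ν.toMeasure.real Set.univ := by
      have := (ENNReal.toReal_lt_toReal ENNReal.coe_ne_top (measure_ne_top _ _)).2 (not_le.1 h1)
      exact this
    change 1 ≤ ∫ _, ((j : ℝ) + 1)⁻¹ ∂ν.toMeasure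
    rw [integral_const, smul_eq_mul, ← div_eq_mul_inv, one_le_div (by positivity)]
    exact h2.le

lemma tendsto_smallConst (x : Life) : Tendsto (fun j => (smallConst j).toFun x) atTop (𝓝 0) := by
  have := tendsto_one_div_add_atTop_nhds_zero_nat (𝕜 := ℝ)
  simpa [smallConst, one_div] using this

lemma tendsto_outside (x : Life) : Tendsto (fun j => (outside j).toFun x) atTop (𝓝 0) := by
  refine tendsto_const_nhds.congr' ?_
  filter_upwards [eventually_mem_window x] with j hj
  exact (Set.indicator_of_notMem (s := (window j)ᶜ) (fun h => h hj) fun _ => (1 : ℝ)).symm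

/-- A family of laws whose Laplace functionals are controlled by travel times is tight. -/
lemma exists_tightness_bound {N : Measure Life} (hN : ∫⁻ x : Life, ENNReal.ofReal x ∂N < ⊤)
    {c : ℝ≥0∞} (hc : c ≠ ⊤) : ∃ v : ℕ → ℝ≥0, Tendsto v atTop (𝓝 0) ∧
      ∀ P : ProbabilityMeasure IntMeasure, (∀ f : BPos,
        ENNReal.ofReal (1 - ∫ ν, Real.exp (-ν.pair f.toFun) ∂(P : Measure IntMeasure)) ≤
          c * ∫⁻ x : Life, travel (absDiff f 0) x ∂N) → ∀ j, P (compacts j)ᶜ ≤ v j := by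
  -- One term for each way of leaving `compacts j`, with the factor `2` of `measure_one_le_pair_le`.
  -- The bound depends only on `N` and `c`, hence is uniform over the family.
  let w : ℕ → ℝ≥0∞ := fun j => 2 * (c * ∫⁻ x : Life, travel (absDiff (smallConst j) 0) x ∂N) +
    2 * (c * ∫⁻ x : Life, travel (absDiff (outside j) 0) x ∂N)
  have hlim : ∀ F : ℕ → BPos, (∀ n x, (F n).toFun x ≤ 1) →
      (∀ x, Tendsto (fun n => (F n).toFun x) atTop (𝓝 0)) →
      Tendsto (fun j => 2 * (c * ∫⁻ x : Life, travel (absDiff (F j) 0) x ∂N)) atTop (𝓝 0) := by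
    intro F hF hF0
    have h := tendsto_lintegral_travel hN (f := 0) hF (fun _ => zero_le_one) hF0
    have h2 := ENNReal.Tendsto.const_mul (ENNReal.Tendsto.const_mul h (.inr hc))
      (.inr (ENNReal.ofNat_ne_top (n := 2)))
    simpa using h2
  have hw : Tendsto w atTop (𝓝 0) := by
    rw [← add_zero (0 : ℝ≥0∞)]
    refine (hlim smallConst (fun n x => ?_) tendsto_smallConst).add
      (hlim outside (fun n x => ?_) tendsto_outside)
    · exact inv_le_one_of_one_le₀ (by simp)
    · exact Set.indicator_le_self' (fun _ _ => zero_le_one) _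
  have hwfin : ∀ j, w j ≠ ⊤ := fun j => ENNReal.add_ne_top.2
    ⟨ENNReal.mul_ne_top (by simp) (ENNReal.mul_ne_top hc (lintegral_travel_ne_top hN _ _)),
      ENNReal.mul_ne_top (by simp) (ENNReal.mul_ne_top hc (lintegral_travel_ne_top hN _ _))⟩
  refine ⟨fun j => (w j).toNNReal, (ENNReal.tendsto_toNNReal ENNReal.zero_ne_top).comp hw,
    fun P hP j => ?_⟩
  rw [← ENNReal.coe_le_coe, ENNReal.coe_toNNReal (hwfin j),
    ProbabilityMeasure.ennreal_coeFn_eq_coeFn_toMeasure]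
  refine (measure_mono (compl_compacts_subset j)).trans ((measure_union_le _ _).trans ?_)
  exact add_le_add ((measure_one_le_pair_le P _).trans (by gcongr; exact hP _))
    ((measure_one_le_pair_le P _).trans (by gcongr; exact hP _))

/-! ### Laplace functionals of the transition laws -/

/-- By `1 - exp(-r) ≤ r` the deficit is at most the exponent: the descendants of `σ` contribute its
mass times `B`, and immigration contributes `B`. For `t ≥ T` the bound is uniform in `t`, as
tightness requires. -/
lemma ofReal_one_sub_laplace_le {D : BranchingParams} {L : Measure NonzeroIntMeasure}
    [IsFiniteMeasure L] {P : ℝ≥0 → Kernel IntMeasure IntMeasure}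
    (hP : IsImmigrationSemigroup D L P) {C : ℝ≥0} (hC : ∀ y, D.meanRate y ≤ C) {f : BPos}
    {B : ℝ≥0∞} (hgap : C * ∫⁻ t, D.gap f 0 t ≤ B) (hpsi : ∫⁻ s in Set.Ioi (0 : ℝ), ENNReal.ofReal
      |psi L (D.cumulant f s.toNNReal) - psi L (D.cumulant 0 s.toNNReal)| ≤ B)
    {σ : IntMeasure} {T t : ℝ≥0} (hσ : σ.toMeasure {x : Life | (T : ℝ) < x} = 0) (ht : T ≤ t) :
    ENNReal.ofReal (1 - ∫ ν, Real.exp (-ν.pair f.toFun) ∂(hP.law t σ : Measure IntMeasure)) ≤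
      (σ.toMeasure Set.univ + 1) * B := by
  have h1 : ENNReal.ofReal (σ.pair (D.cumulant f t)) ≤ σ.toMeasure Set.univ * B := by
    refine (ofReal_pair_cumulant_le hC f hσ ht).trans ?_
    rw [mul_comm]
    gcongr
    exact (mul_le_mul_right (setLIntegral_le_lintegral _ _) _).trans hgap
  have h2 : ENNReal.ofReal (∫ s in (0 : ℝ)..t, psi L (D.cumulant f s.toNNReal)) ≤ B := by
    rw [intervalIntegral.integral_of_le t.coe_nonneg]
    refine (ENNReal.ofReal_le_ofReal (le_abs_self _)).trans ?_
    rw [← Real.norm_eq_abs, ofReal_norm]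
    refine (enorm_integral_le_lintegral_enorm _).trans (le_trans ?_ hpsi)
    simp only [D.cumulant_zero, psi_zero, sub_zero, Real.enorm_eq_ofReal_abs]
    exact lintegral_mono_set Set.Ioc_subset_Ioi_self
  have h3 : ∫ ν, Real.exp (-ν.pair f.toFun) ∂(hP.law t σ : Measure IntMeasure) =
      Real.exp (-σ.pair (D.cumulant f t) - ∫ s in (0 : ℝ)..t, psi L (D.cumulant f s.toNNReal)) :=
    hP.laplace t σ f
  rw [h3]
  refine le_trans (ENNReal.ofReal_le_ofReal (q := σ.pair (D.cumulant f t) +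
    ∫ s in (0 : ℝ)..t, psi L (D.cumulant f s.toNNReal)) ?_) ?_
  · linarith [Real.add_one_le_exp
      (-σ.pair (D.cumulant f t) - ∫ s in (0 : ℝ)..t, psi L (D.cumulant f s.toNNReal))]
  · refine ENNReal.ofReal_add_le.trans ((add_le_add h1 h2).trans_eq ?_)
    rw [add_mul, one_mul]

lemma tendsto_laplace_law {D : BranchingParams} {L : Measure NonzeroIntMeasure}
    {P : ℝ≥0 → Kernel IntMeasure IntMeasure} (hP : IsImmigrationSemigroup D L P) {f : BPos}
    (hi : IntegrableOn (fun s : ℝ => psi L (D.cumulant f s.toNNReal)) (Set.Ioi 0)) {σ : IntMeasure}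
    (hσ : Tendsto (fun t => σ.pair (D.cumulant f t)) atTop (𝓝 0)) :
    Tendsto (fun t => ∫ ν, Real.exp (-ν.pair f.toFun) ∂(hP.law t σ : Measure IntMeasure)) atTop
      (𝓝 (Real.exp (-∫ s in Set.Ioi (0 : ℝ), psi L (D.cumulant f s.toNNReal)))) := by
  have h1 : Tendsto (fun t : ℝ≥0 => ∫ s in (0 : ℝ)..t, psi L (D.cumulant f s.toNNReal)) atTop
      (𝓝 (∫ s in Set.Ioi (0 : ℝ), psi L (D.cumulant f s.toNNReal))) :=
    intervalIntegral_tendsto_integral_Ioi 0 hi (NNReal.tendsto_coe_atTop.2 tendsto_id)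
  have h2 := (Real.continuous_exp.tendsto _).comp (hσ.neg.sub h1)
  rw [neg_zero, zero_sub] at h2
  exact h2.congr fun t => (hP.laplace t σ f).symm

/-- The positive part of a bounded continuous function. -/
noncomputable def BPos.ofContinuous (f : Life →ᵇ ℝ) : BPos :=
  ⟨fun x => max (f x) 0, by fun_prop, fun _ => le_max_right _ _, ‖f‖, fun x =>
    max_le ((le_abs_self _).trans (f.norm_coe_le_norm x)) (norm_nonneg f)⟩

lemma BPos.ofContinuous_toFun {f : Life →ᵇ ℝ} (hf : ∀ x, 0 ≤ f x) :
    (BPos.ofContinuous f).toFun = f :=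
  funext fun x => max_eq_left (hf x)

lemma BPos.exists_boundedContinuous (f : BPos) (hf : Continuous f.toFun) :
    ∃ f' : Life →ᵇ ℝ, (f' : Life → ℝ) = f.toFun := by
  obtain ⟨K, hK⟩ := f.bdd
  exact ⟨BoundedContinuousFunction.ofNormedAddCommGroup f.toFun hf K fun x => by
    rw [Real.norm_of_nonneg (f.nonneg x)]; exact hK x, rfl⟩

end AgeBranching

/-! ### The limit law -/

open AgeBranching
theorem mainTheorem3 (D : BranchingParams) (L : Measure NonzeroIntMeasure) [IsFiniteMeasure L]
    (P : ℝ≥0 → Kernel IntMeasure IntMeasure) (hP : IsImmigrationSemigroup D L P)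
    (α₁ : ℝ) (hα₁ : SubcriticalCramer D α₁)
    (hL : ∫⁻ ν, ∫⁻ x, ENNReal.ofReal (Real.exp (α₁ * (x : ℝ))) ∂ν.1.toMeasure ∂L < ⊤) :
    ∃ η : ProbabilityMeasure IntMeasure,
      (∀ σ : IntMeasure, Tendsto (fun t => hP.law t σ) atTop (𝓝 η)) ∧
      ∀ f : BPos,
        IntegrableOn (fun s : ℝ => psi L (D.cumulant f s.toNNReal)) (Set.Ioi 0) ∧
        ∫ ν, Real.exp (-ν.pair f.toFun) ∂(η : Measure IntMeasure) =
          Real.exp (-∫ s in Set.Ioi (0 : ℝ), psi L (D.cumulant f s.toNNReal)) := by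
  obtain ⟨C, hC⟩ := D.exists_meanRate_le
  obtain ⟨N, hN, hctrl⟩ := exists_measure_control L hα₁ hL hC
  have hi : ∀ f : BPos, IntegrableOn (fun s : ℝ => psi L (D.cumulant f s.toNNReal)) (Set.Ioi 0) :=
    fun f => integrableOn_psi_cumulant (lintegral_travel_ne_top hN f 0) (hctrl f 0).2
  have hlap : ∀ (σ : IntMeasure) (f : BPos), Tendsto
      (fun t => ∫ ν, Real.exp (-ν.pair f.toFun) ∂(hP.law t σ : Measure IntMeasure)) atTop
      (𝓝 (Real.exp (-∫ s in Set.Ioi (0 : ℝ), psi L (D.cumulant f s.toNNReal)))) := fun σ f =>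
    tendsto_laplace_law hP (hi f) (tendsto_pair_cumulant hC f
      (ne_top_of_le_ne_top (lintegral_travel_ne_top hN f 0) (hctrl f 0).1) σ)
  -- The bound `v` depends on `σ` through its total mass and holds once the initial individuals are
  -- dead; the compact sets are the same for all `σ`.
  have htight : ∀ σ : IntMeasure, ∃ v : ℕ → ℝ≥0, Tendsto v atTop (𝓝 0) ∧
      ∀ᶠ t in atTop, ∀ j, hP.law t σ (compacts j)ᶜ ≤ v j := by
    intro σ
    obtain ⟨T, hT⟩ := σ.exists_measure_Ioi_eq_zero
    obtain ⟨v, hv, hvP⟩ := exists_tightness_bound hN (c := σ.toMeasure Set.univ + 1)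
      (by finiteness)
    refine ⟨v, hv, ?_⟩
    filter_upwards [eventually_ge_atTop T] with t ht
    exact hvP _ fun f => ofReal_one_sub_laplace_le hP hC (hctrl f 0).1 (hctrl f 0).2 hT ht
  -- The limiting Laplace functional does not depend on `σ`, so `η` is built from the process
  -- started at the zero measure.
  obtain ⟨w, hw, hw0⟩ := htight 0
  obtain ⟨η, hηw, hη⟩ := exists_laplace_eq_of_tendsto isCompact_compacts compacts_mono hw hw0
    (Φ := fun f => Real.exp (-∫ s in Set.Ioi (0 : ℝ),
      psi L (D.cumulant (BPos.ofContinuous f) s.toNNReal)))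
    fun f hf => by simpa only [BPos.ofContinuous_toFun hf] using hlap 0 (BPos.ofContinuous f)
  -- Weak limits determine `η` only on continuous test functions; continuity of the exponent under
  -- bounded limits extends the formula to Borel ones.
  have hηlap := laplace_eq_of_continuous (D := D) (L := L) hN (fun f h => (hctrl f h).2) (η := η)
    fun f hf => by
      obtain ⟨f', hf'⟩ := f.exists_boundedContinuous hf
      have h0 : ∀ x, 0 ≤ f' x := fun x => by rw [hf']; exact f.nonneg x
      have he : BPos.ofContinuous f' = f := by
        have := (BPos.ofContinuous_toFun h0).trans hf'
        cases f
        cases h : BPos.ofContinuous f'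
        simp_all
      have := hη f' h0
      rwa [he, hf'] at this
  refine ⟨η, fun σ => ?_, fun f => ⟨hi f, hηlap f⟩⟩
  obtain ⟨v, hv, hvt⟩ := htight σ
  refine tendsto_of_tendsto_laplace isCompact_compacts compacts_mono hv hw hvt hηw fun f hf => ?_
  have h := hlap σ (BPos.ofContinuous f)
  rw [← hηlap, BPos.ofContinuous_toFun hf] at h
  exact h
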